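/- Let $G$ be a locally compact (Hausdorff), second countable, amenable group with left Haar measure $\mathrm{m}$, and let $\Phi=(\Phi_N)_{N\in\mathbb N}$ be a left Følner sequence in $G$, i.e. a sequence of compact sets of positive measure with $\mathrm{m}(\Phi_N\,\triangle\, g\Phi_N)/\mathrm{m}(\Phi_N)\to 0$ for every $g\in G$. A system is a probability space whose $\sigma$-algebra is countably generated and separates points, with an action $T$ of $G$ by measure-preserving transformations such that $(g,x)\mapsto T^g x$ is jointly measurable. Write $(T^gf)(x)=f(T^gx)$. Let $\mathbf X=(X,\mathscr B,\mu,T)$ be an extension of $\mathbf Y=(Y,\mathscr D,\nu,S)$: both are systems and there is a measurable, measure-preserving map $\pi:X\to Y$ with $\pi(T^gx)=S^g\pi(x)$ for all $g\in G$, $x\in X$. All function spaces are real; $L^\infty(\mathbf Y)$ acts on $L^2(\mathbf X)$ by $(\alpha f)(x)=\alpha(\pi x)f(x)$, and $\mathbb E(\,\cdot\,|\mathbf Y)$ is the conditional expectation on $\pi^{-1}\mathscr D$. A function $f\in L^2(\mathbf X)$ is an eigenfunction over $\mathbf Y$ if the closed $L^\infty(\mathbf Y)$-submodule $\mathscr M$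 of $L^2(\mathbf X)$ spanned by its orbit $\{T^gf:g\in G\}$ has finite rank, i.e. there are $d\ge 0$ and $\phi_1,\dots,\phi_d\in L^2(\mathbf X)$ such that $\{\alpha^1\phi_1+\cdots+\alpha^d\phi_d:\alpha^1,\dots,\alpha^d\in L^\infty(\mathbf Y)\}$ is a dense subset of $\mathscr M$. Let $\mathrm{Eig}(\mathbf X|\mathbf Y)$ be the closed linear subspace of $L^2(\mathbf X)$ spanned by the eigenfunctions over $\mathbf Y$. Let $\mathcal W(\mathbf X|\mathbf Y)$ be the set of $f\in L^2(\mathbf X)$ that are weakly mixing for $\mathbf X\to\mathbf Y$, i.e. $$\lim_{N\to\infty}\frac1{\mathrm{m}(\Phi_N)}\int_{\Phi_N}\int|\mathbb E(\phi\cdot T^gf\,|\,\mathbf Y)|^2\,d\mu\,d\mathrm{m}(g)=0\quad\text{for every }\phi\in L^\infty(\mathbf X).$$ Then $\mathcal W(\mathbf X|\mathbf Y)$ is a closed linear subspace of $L^2(\mathbf X)$, and $L^2(\mathbf X)=\mathrm{Eig}(\mathbf X|\mathbf Y)\oplus\mathcal W(\mathbf X|\mathbf Y)$ is an orthogonal direct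 sum. -/

import Mathlib

open MeasureTheory Filter Topology
open scoped ENNReal

noncomputable section

namespace RelativeMixing

variable {G : Type*} [Group G] [MeasurableSpace G]
  {X : Type*} [MeasurableSpace X] [MulAction G X] [MeasurableSMul₂ G X]
  {Y : Type*} [MeasurableSpace Y] [MulAction G Y]

/-- `π : X → Y` is a factor map between measure-preserving `G`-systems: it is measurable,
measure-preserving and intertwines the two actions. -/
structure IsFactorMap (G : Type*) [Group G] {X : Type*} [MeasurableSpace X] [MulAction G X]
    {Y : Type*} [MeasurableSpace Y] [MulAction G Y]
    (μ : Measure X) (ν : Measure Y) (π : X → Y) : Prop where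
  measurePreserving : MeasurePreserving π μ ν
  map_smul : ∀ (g : G) (x : X), π (g • x) = g • π x

/-- The operator `T^g` on (real) `L²(X)`, `(T^g f)(x) = f (g • x)`. -/
def koopman (μ : Measure X) [SMulInvariantMeasure G X μ] (g : G) (f : Lp ℝ 2 μ) : Lp ℝ 2 μ :=
  Lp.compMeasurePreserving (fun x : X => g • x) (measurePreserving_smul g μ) f

/-- The `L^∞(Y)`-module structure of `L²(X)` given by a factor map: the product of `α ∘ π` and
`f`. -/
def baseMul {μ : Measure X} {ν : Measure Y} {π : X → Y} (hπ : IsFactorMap G μ ν π)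
    (α : Lp ℝ ∞ ν) (f : Lp ℝ 2 μ) : Lp ℝ 2 μ :=
  (Lp.compMeasurePreserving π hπ.measurePreserving α : Lp ℝ ∞ μ) • f

/-- The closed `L^∞(Y)`-submodule of `L²(X)` spanned by the orbit of `f`: the closure of the set of
finite sums of the functions `α · T^g f` with `α ∈ L^∞(Y)` and `g ∈ G`. -/
def orbitModule {μ : Measure X} [SMulInvariantMeasure G X μ] {ν : Measure Y} {π : X → Y}
    (hπ : IsFactorMap G μ ν π) (f : Lp ℝ 2 μ) : Submodule ℝ (Lp ℝ 2 μ) :=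
  (Submodule.span ℝ
    {h | ∃ (α : Lp ℝ ∞ ν) (g : G), h = baseMul hπ α (koopman μ g f)}).topologicalClosure

/-- `f` is an eigenfunction over `Y`: the closed `L^∞(Y)`-module spanned by its orbit has finite
rank, i.e. there are `φ₁, …, φ_d ∈ L²(X)` such that
`{α₁ φ₁ + ⋯ + α_d φ_d : α₁, …, α_d ∈ L^∞(Y)}` is a dense subset of it. -/
def IsEigenfunction {μ : Measure X} [SMulInvariantMeasure G X μ] {ν : Measure Y} {π : X → Y}
    (hπ : IsFactorMap G μ ν π) (f : Lp ℝ 2 μ) : Prop :=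
  ∃ (d : ℕ) (φ : Fin d → Lp ℝ 2 μ),
    closure {h : Lp ℝ 2 μ | ∃ α : Fin d → Lp ℝ ∞ ν, h = ∑ i, baseMul hπ (α i) (φ i)}
      = (orbitModule hπ f : Set (Lp ℝ 2 μ))

/-- `Eig(X|Y)`: the closed subspace of `L²(X)` spanned by the eigenfunctions over `Y`. -/
def eig {μ : Measure X} [SMulInvariantMeasure G X μ] {ν : Measure Y} {π : X → Y}
    (hπ : IsFactorMap G μ ν π) : Submodule ℝ (Lp ℝ 2 μ) :=
  (Submodule.span ℝ {f | IsEigenfunction hπ f}).topologicalClosure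

/-- `W(X|Y)`: the functions that are weakly mixing for the extension `π : X → Y`, with respect to
the measure `m` on `G` and the sequence `Φ` of subsets of `G`. The conditional expectation on `Y` is
the one on the σ-algebra of preimages under `π` of measurable subsets of `Y`. -/
def weaklyMixing (m : Measure G) (Φ : ℕ → Set G) (μ : Measure X) [SMulInvariantMeasure G X μ]
    (π : X → Y) : Set (Lp ℝ 2 μ) :=
  {f | ∀ φ : Lp ℝ ∞ μ,
    Tendsto
      (fun N => ⨍ g in Φ N,
        (∫ x, |(μ[((φ • koopman μ g f : Lp ℝ 2 μ) : X → ℝ) |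
          MeasurableSpace.comap π inferInstance]) x| ^ 2 ∂μ) ∂m)
      atTop (𝓝 0)}

end RelativeMixing

end

/-!
Write `n` for the σ-algebra that the factor `Y` induces on `X`, `condInner n f h = 𝔼(f h | n)`, and
call a closed subspace of `L²(X)` that is stable under bounded `n`-measurable multipliers a closed
module. The size `corr n φ f g = ∫ |𝔼(φ · T^g f | n)|²` of the correlations is controlled by the
norm of `f` when `φ` is bounded, and by the norm of `φ` when `f` is conditionally bounded, that is
when `𝔼(f² | n)` is bounded. Hence the weakly mixing functions form a closed subspace `W`, and both
`φ` and `f` may be replaced by approximations.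

**Rank.** The rank of a closed module is encoded by conditionally orthonormal families over sets of
positive measure (`RankLE`), a notion that obviously passes to submodules. The Gram–Schmidt process
over `n` and Bessel's inequality show that `d` generators force rank at most `d`
(`rankLE_of_generatedBy`), and splitting off vectors of maximal support gives the converse
(`IsClosedModule.exists_generators`). So the eigenfunctions are exactly the elements of the
invariant closed modules of finite rank (`isEigenfunction_iff`), and `Eig` is itself an invariant
closed module.

**Orthogonality.** Let `e` lie in an invariant closed module with conditionally orthonormal
generators `uᵢ`, and let `f ∈ W` be conditionally bounded. Expanding `T^g e` in the `uᵢ` bounds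
`⟨e, f⟩ = ⟨T^g e, T^g f⟩` by `‖e‖ ∑ᵢ ‖𝔼(uᵢ · T^g f | n)‖`, whose average over `g` tends to `0`
(`inner_eq_zero_of_isCondBounded`).

**Decay of correlations.** For `Eigᗮ ≤ W` one may project the test function `φ` to `Eigᗮ`. By
approximation it suffices to test against a fixed conditionally bounded `w ∈ Eigᗮ`, and the vector
moved by the action may then be arbitrary. Along any ultrafilter the averaged forms
`(φ, ψ) ↦ ⨍ g in Φ_N, ⟨𝔼(w · T^g φ | n), 𝔼(w · T^g ψ | n)⟩` converge to the form of a positive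
operator `A`, which commutes with the `n`-measurable multipliers and, by the left Følner property,
with the action; it vanishes on `Eig`. Summed over a conditionally orthonormal family, the
correlations with `w` are bounded, by Bessel's inequality: `A` has finite conditional trace.
Therefore the range of the positive part of `A - ε` spans an invariant closed module of finite rank,
so it lies in `Eig`, and this forces `⟨A h, h⟩ ≤ ε ‖h‖²` on `Eigᗮ`. As `ε > 0` is arbitrary, `A = 0`
(`tendsto_average_corr_of_mem_orthogonal`, resting on `inner_self_eq_zero_of_range_le`).

Square roots of operators on a real Hilbert space, needed for the positive part, come from the
fixed-point iteration of `exists_half_add_mul_self`.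
-/

noncomputable section

set_option linter.unusedSectionVars false

namespace RelativeMixing

/-! ### Bounded operators on a real Hilbert space -/

/-- The fixed point of `X ↦ (B + X²) / 2` for a contraction `B`, which makes `1 - X` a square root
of `1 - B`. It is a norm limit of iterates starting at `0`; the norms of the iterates and of their
increments are dominated by the same recursion for the real number `1`. -/
lemma exists_half_add_mul_self {𝔸 : Type*} [NormedRing 𝔸] [NormedAlgebra ℝ 𝔸] [CompleteSpace 𝔸]
    (B : 𝔸) (hB : ‖B‖ ≤ 1) :
    ∃ X : 𝔸, ‖X‖ ≤ 1 ∧ X = (1 / 2 : ℝ) • (B + X * X) ∧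
      ∀ T : 𝔸, T * B = B * T → T * X = X * T := by
  let F : 𝔸 → 𝔸 := fun X => (1 / 2 : ℝ) • (B + X * X)
  let φ : ℝ → ℝ := fun x => (1 / 2 : ℝ) * (1 + x * x)
  let X : ℕ → 𝔸 := fun k => F^[k] 0
  let r : ℕ → ℝ := fun k => φ^[k] 0
  have hXs : ∀ k, X (k + 1) = (1 / 2 : ℝ) • (B + X k * X k) := fun k =>
    Function.iterate_succ_apply' F k 0
  have hrs : ∀ k, r (k + 1) = (1 / 2 : ℝ) * (1 + r k * r k) := fun k =>
    Function.iterate_succ_apply' φ k 0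
  have hr : ∀ k, 0 ≤ r k ∧ r k ≤ 1 := by
    intro k
    induction k with
    | zero => exact ⟨le_rfl, zero_le_one⟩
    | succ k ih => rw [hrs]; constructor <;> nlinarith [ih.1, ih.2]
  have hX : ∀ k, ‖X k‖ ≤ r k := by
    intro k
    induction k with
    | zero => simp [X, r]
    | succ k ih =>
      rw [hXs, hrs, norm_smul, Real.norm_of_nonneg (by norm_num : (0 : ℝ) ≤ 1 / 2)]
      have h1 : ‖X k * X k‖ ≤ r k * r k :=
        (norm_mul_le _ _).trans (mul_le_mul ih ih (norm_nonneg _) (hr k).1)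
      have h2 := norm_add_le B (X k * X k)
      gcongr
      linarith
  have hd : ∀ k, ‖X (k + 1) - X k‖ ≤ r (k + 1) - r k := by
    intro k
    induction k with
    | zero =>
      simp only [hXs, hrs]
      simp only [X, r, Function.iterate_zero, id, mul_zero, add_zero, sub_zero, mul_one]
      rw [norm_smul, Real.norm_of_nonneg (by norm_num : (0 : ℝ) ≤ 1 / 2)]
      linarith
    | succ k ih =>
      have e1 : X (k + 1 + 1) - X (k + 1) = (1 / 2 : ℝ) •
          (X (k + 1) * (X (k + 1) - X k) + (X (k + 1) - X k) * X k) := by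
        rw [hXs (k + 1), hXs k, ← smul_sub, ← hXs k]; congr 1; noncomm_ring
      have e2 : r (k + 1 + 1) - r (k + 1) = (1 / 2 : ℝ) *
          (r (k + 1) * (r (k + 1) - r k) + (r (k + 1) - r k) * r k) := by
        linear_combination hrs (k + 1) - hrs k
      rw [e1, e2, norm_smul, Real.norm_of_nonneg (by norm_num : (0 : ℝ) ≤ 1 / 2)]
      have hd0 : 0 ≤ r (k + 1) - r k := (norm_nonneg _).trans ih
      have h1 : ‖X (k + 1) * (X (k + 1) - X k)‖ ≤ r (k + 1) * (r (k + 1) - r k) :=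
        (norm_mul_le _ _).trans (mul_le_mul (hX _) ih (norm_nonneg _) (hr _).1)
      have h2 : ‖(X (k + 1) - X k) * X k‖ ≤ (r (k + 1) - r k) * r k :=
        (norm_mul_le _ _).trans (mul_le_mul ih (hX _) (norm_nonneg _) hd0)
      have h3 := norm_add_le (X (k + 1) * (X (k + 1) - X k)) ((X (k + 1) - X k) * X k)
      gcongr
      linarith
  have hsum : Summable fun k => ‖X (k + 1) - X k‖ := by
    refine summable_of_sum_range_le (c := 1) (fun _ => norm_nonneg _) fun k => ?_
    calc ∑ i ∈ Finset.range k, ‖X (i + 1) - X i‖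
        ≤ ∑ i ∈ Finset.range k, (r (i + 1) - r i) := Finset.sum_le_sum fun i _ => hd i
      _ = r k - r 0 := Finset.sum_range_sub r k
      _ ≤ 1 := by simpa [r] using (hr k).2
  have hc : CauchySeq X := by
    refine cauchySeq_of_summable_dist ?_
    simpa only [dist_eq_norm, norm_sub_rev] using hsum
  obtain ⟨L, hL⟩ := cauchySeq_tendsto_of_complete hc
  refine ⟨L, ?_, ?_, fun T hT => ?_⟩
  · exact le_of_tendsto hL.norm (Eventually.of_forall fun k => (hX k).trans (hr k).2)
  · refine tendsto_nhds_unique (hL.comp (tendsto_add_atTop_nat 1)) ?_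
    have := ((hL.mul hL).const_add B).const_smul (1 / 2 : ℝ)
    exact this.congr fun k => (hXs k).symm
  · have hk : ∀ k, T * X k = X k * T := by
      intro k
      induction k with
      | zero => simp [X]
      | succ k ih =>
        rw [hXs, mul_smul_comm, smul_mul_assoc, mul_add, add_mul, hT, ← mul_assoc, ih, mul_assoc,
          ih, mul_assoc]
    exact tendsto_nhds_unique (hL.const_mul T) ((hL.mul_const T).congr fun k => (hk k).symm)

section Hilbert

variable {H : Type*} [NormedAddCommGroup H] [InnerProductSpace ℝ H] [CompleteSpace H]

/-- The absolute value of a symmetric operator `S`: a positive square root of `S²` that commutes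
with everything that commutes with `S`. -/
lemma exists_abs_of_symmetric (S : H →L[ℝ] H) (hS : ∀ x y, inner ℝ (S x) y = inner ℝ x (S y)) :
    ∃ R : H →L[ℝ] H, (∀ x, 0 ≤ inner ℝ (R x) x) ∧ R * R = S * S ∧
      ∀ T : H →L[ℝ] H, T * S = S * T → T * R = R * T := by
  -- The scaling by `c` makes `1 - S² / c` a contraction.
  set c : ℝ := ‖S‖ ^ 2 + 1 with hc
  have hc0 : 0 < c := by positivity
  set B : H →L[ℝ] H := 1 - c⁻¹ • (S * S) with hB
  have hB1 : ‖B‖ ≤ 1 := by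
    refine ContinuousLinearMap.opNorm_le_bound _ zero_le_one fun h => ?_
    rw [one_mul]
    refine abs_le_of_sq_le_sq' ?_ (norm_nonneg _) |>.2
    have e : B h = h - c⁻¹ • S (S h) := by simp [hB]
    rw [e, norm_sub_sq_real, inner_smul_right, ← hS h (S h), real_inner_self_eq_norm_sq, norm_smul,
      Real.norm_of_nonneg (inv_nonneg.2 hc0.le)]
    have h1 : ‖S (S h)‖ ^ 2 ≤ c * ‖S h‖ ^ 2 := by
      calc ‖S (S h)‖ ^ 2 ≤ (‖S‖ * ‖S h‖) ^ 2 := by gcongr; exact S.le_opNorm _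
        _ = ‖S‖ ^ 2 * ‖S h‖ ^ 2 := by ring
        _ ≤ c * ‖S h‖ ^ 2 := by gcongr; linarith
    have h2 : (c⁻¹ * ‖S (S h)‖) ^ 2 ≤ c⁻¹ * ‖S h‖ ^ 2 := by
      calc (c⁻¹ * ‖S (S h)‖) ^ 2 = c⁻¹ ^ 2 * ‖S (S h)‖ ^ 2 := by ring
        _ ≤ c⁻¹ ^ 2 * (c * ‖S h‖ ^ 2) := by gcongr
        _ = c⁻¹ * ‖S h‖ ^ 2 := by field_simp
    have h3 : 0 ≤ c⁻¹ * ‖S h‖ ^ 2 := by positivity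
    linarith
  obtain ⟨X, hX1, hX, hXc⟩ := exists_half_add_mul_self B hB1
  refine ⟨Real.sqrt c • (1 - X), fun x => ?_, ?_, fun T hT => ?_⟩
  · have h1 : inner ℝ (X x) x ≤ ‖x‖ * ‖x‖ := by
      refine (real_inner_le_norm _ _).trans ?_
      gcongr
      simpa using X.le_of_opNorm_le hX1 x
    simp only [smul_apply, sub_apply, one_apply_eq_self, inner_smul_left, inner_sub_left,
      real_inner_self_eq_norm_mul_norm]
    exact mul_nonneg (Real.sqrt_nonneg _) (by linarith)
  · have h2 : X + X = B + X * X := by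
      nth_rewrite 1 2 [hX]
      rw [← add_smul]; norm_num
    have h1 : (1 - X) * (1 - X) = c⁻¹ • (S * S) := by
      have : (1 - X) * (1 - X) = 1 - (X + X) + X * X := by noncomm_ring
      rw [this, h2, hB]; abel
    rw [smul_mul_smul_comm, Real.mul_self_sqrt hc0.le, h1, smul_smul, mul_inv_cancel₀ hc0.ne',
      one_smul]
  · have h1 : T * B = B * T := by
      rw [hB, mul_sub, sub_mul, mul_one, one_mul, mul_smul_comm, smul_mul_assoc, ← mul_assoc, hT,
        mul_assoc, hT, mul_assoc]
    rw [mul_smul_comm, smul_mul_assoc, mul_sub, sub_mul, hXc T h1, mul_one, one_mul]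

/-- Let `A` be a positive operator that vanishes on a closed subspace `K`. If `K` contains the range
of each operator `θ` in the bicommutant of `A` such that `A` is bounded below by some `ε > 0` on
that range, then the quadratic form of `A` is zero. The test operators are
`θ = (A - ε) + |A - ε|`, twice the positive part of `A - ε`. -/
lemma inner_self_eq_zero_of_range_le (A : H →L[ℝ] H)
    (hA : ∀ x y, inner ℝ (A x) y = inner ℝ x (A y)) (hpos : ∀ x, 0 ≤ inner ℝ (A x) x)
    (K : Submodule ℝ H) [K.HasOrthogonalProjection] (hK : ∀ k ∈ K, A k = 0)
    (hrange : ∀ (ε : ℝ) (θ : H →L[ℝ] H), 0 < ε →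
      (∀ T : H →L[ℝ] H, T * A = A * T → T * θ = θ * T) →
      (∀ x, ε * ‖θ x‖ ^ 2 ≤ inner ℝ (A (θ x)) (θ x)) → ∀ x, θ x ∈ K) (x : H) :
    inner ℝ (A x) x = 0 := by
  have key : ∀ h ∈ Kᗮ, inner ℝ (A h) h = 0 := by
    intro h hh
    refine le_antisymm (le_of_forall_pos_le_add fun δ hδ => ?_) (hpos h)
    obtain ⟨ε, hε, hεδ⟩ : ∃ ε > 0, ε * ‖h‖ ^ 2 ≤ δ := by
      refine ⟨δ / (‖h‖ ^ 2 + 1), by positivity, ?_⟩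
      rw [div_mul_eq_mul_div, div_le_iff₀ (by positivity)]
      nlinarith
    set S : H →L[ℝ] H := A - ε • 1 with hS
    have hSs : ∀ x y, inner ℝ (S x) y = inner ℝ x (S y) := by
      intro x y
      simp [hS, inner_sub_left, inner_sub_right, inner_smul_left, inner_smul_right, hA]
    obtain ⟨R, hR, hRR, hRc⟩ := exists_abs_of_symmetric S hSs
    have hSR : S * R = R * S := hRc S rfl
    have hθ := hrange ε (S + R) hε (fun T hT => by
      have h1 : T * S = S * T := by
        rw [hS, mul_sub, sub_mul, hT, mul_smul_comm, smul_mul_assoc, mul_one, one_mul]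
      rw [mul_add, add_mul, h1, hRc T h1]) (fun x => by
      have e : S * (S + R) = R * (S + R) := by rw [mul_add, mul_add, hSR, hRR, add_comm]
      have e' : S ((S + R) x) = R ((S + R) x) := DFunLike.congr_fun e x
      have e2 : A ((S + R) x) = S ((S + R) x) + ε • (S + R) x := by simp [hS]
      rw [e2, e', inner_add_left, inner_smul_left, real_inner_self_eq_norm_sq]
      simpa using hR ((S + R) x)) h
    -- As `(S + R) h ∈ K` is orthogonal to `h` and `R ≥ 0`, the form of `S = A - ε` is nonpositive
    -- at `h`.
    have h0 : inner ℝ ((S + R) h) h = 0 := Submodule.inner_right_of_mem_orthogonal hθ hh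
    have h1 : inner ℝ (S h) h = inner ℝ (A h) h - ε * ‖h‖ ^ 2 := by
      simp [hS, inner_sub_left, inner_smul_left]
    rw [add_apply, inner_add_left, h1] at h0
    linarith [hR h]
  obtain ⟨k, hk, h, hh, rfl⟩ := K.exists_add_mem_mem_orthogonal x
  rw [map_add, hK k hk, zero_add, inner_add_right, hA h k, hK k hk, inner_zero_right, zero_add,
    key h hh]

/-- Weak operator compactness: a uniformly bounded family of bilinear forms converges pointwise
along an ultrafilter, to a form represented by a bounded operator. -/
lemma exists_operator_tendsto_ultrafilter {ι : Type*} (U : Ultrafilter ι)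
    (F : ι → H →ₗ[ℝ] H →ₗ[ℝ] ℝ) (C : ℝ) (hF : ∀ i x y, |F i x y| ≤ C * ‖x‖ * ‖y‖) :
    ∃ A : H →L[ℝ] H, ∀ x y, Tendsto (fun i => F i x y) U (𝓝 (inner ℝ (A x) y)) := by
  have hlim : ∀ x y, ∃ l, Tendsto (fun i => F i x y) U (𝓝 l) := by
    intro x y
    obtain ⟨l, -, hl⟩ :=
      (isCompact_Icc (a := -(C * ‖x‖ * ‖y‖)) (b := C * ‖x‖ * ‖y‖)).ultrafilter_le_nhds
      (U.map fun i => F i x y) (by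
        rw [le_principal_iff, Ultrafilter.mem_coe, Ultrafilter.mem_map]
        exact Filter.univ_mem' fun i => abs_le.1 (hF i x y))
    exact ⟨l, hl⟩
  choose L hL using hlim
  let Λ : H →ₗ[ℝ] H →ₗ[ℝ] ℝ := LinearMap.mk₂ ℝ L
    (fun x x' y => tendsto_nhds_unique (hL _ _) (by simpa using (hL x y).add (hL x' y)))
    (fun c x y => tendsto_nhds_unique (hL _ _) (by simpa using (hL x y).const_mul c))
    (fun x y y' => tendsto_nhds_unique (hL _ _) (by simpa using (hL x y).add (hL x y')))
    (fun c x y => tendsto_nhds_unique (hL _ _) (by simpa using (hL x y).const_mul c))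
  let Λ' : H →L[ℝ] H →L[ℝ] ℝ := Λ.mkContinuous₂ C fun x y =>
    le_of_tendsto (hL x y).norm (Eventually.of_forall fun i => hF i x y)
  refine ⟨InnerProductSpace.continuousLinearMapOfBilin (𝕜 := ℝ) Λ', fun x y => ?_⟩
  rw [InnerProductSpace.continuousLinearMapOfBilin_apply]
  exact hL x y

end Hilbert

/-! ### The conditional inner product -/

section CondInner

variable {X : Type*} {n mX : MeasurableSpace X} {μ : Measure X}

/-- The conditional inner product `𝔼(f h | n)` of two square-integrable functions, a function
on `X` that is measurable for the sub-σ-algebra `n`. -/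
def condInner (n : MeasurableSpace X) {mX : MeasurableSpace X} {μ : Measure X}
    (f h : Lp ℝ 2 μ) : X → ℝ :=
  μ[fun x => f x * h x | n]

lemma integrable_mul_Lp (f h : Lp ℝ 2 μ) : Integrable (fun x => f x * h x) μ :=
  (Lp.memLp f).integrable_mul (Lp.memLp h)

lemma inner_eq_integral_mul (f h : Lp ℝ 2 μ) : inner ℝ f h = ∫ x, f x * h x ∂μ := by
  rw [L2.inner_def]
  exact integral_congr_ae (Eventually.of_forall fun x => by simp [mul_comm])

lemma norm_sq_eq_integral (f : Lp ℝ 2 μ) : ‖f‖ ^ 2 = ∫ x, f x ^ 2 ∂μ := by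
  rw [← real_inner_self_eq_norm_sq, inner_eq_integral_mul]
  simp only [sq]

lemma stronglyMeasurable_condInner (f h : Lp ℝ 2 μ) : StronglyMeasurable[n] (condInner n f h) :=
  stronglyMeasurable_condExp

lemma integrable_condInner (f h : Lp ℝ 2 μ) : Integrable (condInner n f h) μ :=
  integrable_condExp

lemma condInner_comm (f h : Lp ℝ 2 μ) : condInner n f h = condInner n h f := by
  simp only [condInner, mul_comm]

lemma condInner_add_right (f h k : Lp ℝ 2 μ) :
    condInner n f (h + k) =ᵐ[μ] fun x => condInner n f h x + condInner n f k x := by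
  refine (condExp_congr_ae ?_).trans
    (condExp_add (integrable_mul_Lp f h) (integrable_mul_Lp f k) n)
  filter_upwards [Lp.coeFn_add h k] with x hx
  simp only [hx, Pi.add_apply, mul_add]

lemma condInner_sub_right (f h k : Lp ℝ 2 μ) :
    condInner n f (h - k) =ᵐ[μ] fun x => condInner n f h x - condInner n f k x := by
  refine (condExp_congr_ae ?_).trans
    (condExp_sub (integrable_mul_Lp f h) (integrable_mul_Lp f k) n)
  filter_upwards [Lp.coeFn_sub h k] with x hx
  simp only [hx, Pi.sub_apply, mul_sub]

lemma condInner_smul_right (c : ℝ) (f h : Lp ℝ 2 μ) :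
    condInner n f (c • h) =ᵐ[μ] fun x => c * condInner n f h x := by
  refine (condExp_congr_ae ?_).trans (condExp_smul c (fun x => f x * h x) n)
  filter_upwards [Lp.coeFn_smul c h] with x hx
  simp only [hx, Pi.smul_apply, smul_eq_mul]
  ring

lemma condInner_zero_right (f : Lp ℝ 2 μ) : condInner n f 0 =ᵐ[μ] 0 := by
  filter_upwards [condInner_smul_right (n := n) 0 f 0] with x hx
  simpa using hx

lemma condInner_sum_right {ι : Type*} (s : Finset ι) (f : Lp ℝ 2 μ) (h : ι → Lp ℝ 2 μ) :
    condInner n f (∑ i ∈ s, h i) =ᵐ[μ] fun x => ∑ i ∈ s, condInner n f (h i) x := by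
  classical
  induction s using Finset.induction_on with
  | empty => exact condInner_zero_right f
  | insert i s his ih =>
    rw [Finset.sum_insert his]
    filter_upwards [condInner_add_right (n := n) f (h i) (∑ i ∈ s, h i), ih] with x h1 h2
    rw [h1, h2, Finset.sum_insert his]

lemma condInner_self_nonneg (f : Lp ℝ 2 μ) : 0 ≤ᵐ[μ] condInner n f f :=
  condExp_nonneg (Eventually.of_forall fun x => mul_self_nonneg (f x))

/-- The conditional Cauchy–Schwarz inequality. -/
lemma condInner_sq_le (f h : Lp ℝ 2 μ) :
    ∀ᵐ x ∂μ, condInner n f h x ^ 2 ≤ condInner n f f x * condInner n h h x := by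
  have hq : ∀ᵐ x ∂μ, ∀ q : ℚ, 0 ≤ condInner n h h x * ((q : ℝ) * q) +
      2 * condInner n f h x * q + condInner n f f x := by
    refine ae_all_iff.2 fun q => ?_
    filter_upwards [condInner_self_nonneg (n := n) (f + (q : ℝ) • h),
      condInner_add_right (n := n) (f + (q : ℝ) • h) f ((q : ℝ) • h),
      condInner_smul_right (n := n) q (f + (q : ℝ) • h) h,
      condInner_add_right (n := n) f f ((q : ℝ) • h),
      condInner_add_right (n := n) h f ((q : ℝ) • h),
      condInner_smul_right (n := n) q f h, condInner_smul_right (n := n) q h h]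
      with x h0 h1 h2 h3 h4 h5 h6
    rw [condInner_comm _ f] at h1
    rw [condInner_comm _ h] at h2
    rw [h1, h2, h3, h4, h5, h6, condInner_comm h f] at h0
    refine le_of_le_of_eq h0 ?_
    ring
  filter_upwards [hq] with x hx
  -- Nonnegativity of the quadratic polynomial at rational points extends to all reals.
  have hr : ∀ t : ℝ, 0 ≤ condInner n h h x * (t * t) + 2 * condInner n f h x * t +
      condInner n f f x := by
    intro t
    have hcl : IsClosed {t : ℝ | 0 ≤ condInner n h h x * (t * t) + 2 * condInner n f h x * t +
        condInner n f f x} := isClosed_le continuous_const (by fun_prop)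
    have : Dense (Set.range ((↑) : ℚ → ℝ)) := Rat.denseRange_cast
    exact hcl.closure_subset_iff.2 (Set.range_subset_iff.2 hx) (this t)
  have := discrim_le_zero hr
  rw [discrim] at this
  linarith

/-- The conditional inner product is bilinear over functions measurable for `n`, bounded or not. -/
lemma condInner_mul_left {a : X → ℝ} (ha : StronglyMeasurable[n] a) {f f' : Lp ℝ 2 μ}
    (hf : f' =ᵐ[μ] fun x => a x * f x) (h : Lp ℝ 2 μ) :
    condInner n f' h =ᵐ[μ] fun x => a x * condInner n f h x := by
  have e : (fun x => f' x * h x) =ᵐ[μ] a * fun x => f x * h x := by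
    filter_upwards [hf] with x hx
    simp [hx, mul_assoc]
  exact (condExp_congr_ae e).trans (condExp_mul_of_stronglyMeasurable_left ha
    ((integrable_mul_Lp f' h).congr e) (integrable_mul_Lp f h))

lemma condInner_mul_right {a : X → ℝ} (ha : StronglyMeasurable[n] a) {h h' : Lp ℝ 2 μ}
    (hh : h' =ᵐ[μ] fun x => a x * h x) (f : Lp ℝ 2 μ) :
    condInner n f h' =ᵐ[μ] fun x => a x * condInner n f h x := by
  rw [condInner_comm f h', condInner_comm f h]
  exact condInner_mul_left ha hh f

lemma condInner_mul_mul {a : X → ℝ} (ha : StronglyMeasurable[n] a) {h h' : Lp ℝ 2 μ}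
    (hh : h' =ᵐ[μ] fun x => a x * h x) :
    condInner n h' h' =ᵐ[μ] fun x => a x ^ 2 * condInner n h h x := by
  filter_upwards [condInner_mul_right ha hh h', condInner_mul_left ha hh h] with x h1 h2
  rw [h1, h2, sq, mul_assoc]

lemma measurableSet_abs_le {a : X → ℝ} (ha : StronglyMeasurable[n] a) (k : ℝ) :
    MeasurableSet[n] {x | |a x| ≤ k} :=
  (measurable_abs.comp ha.measurable) measurableSet_Iic

lemma tendsto_truncation {a : X → ℝ} (h : Lp ℝ 2 μ) (t : ℕ → Lp ℝ 2 μ)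
    (ht : ∀ k : ℕ, t k =ᵐ[μ] {x | |a x| ≤ k}.indicator h) : Tendsto t atTop (𝓝 h) := by
  rw [tendsto_iff_norm_sub_tendsto_zero]
  have h1 : Tendsto (fun k => ‖t k - h‖ ^ 2) atTop (𝓝 0) := by
    simp only [norm_sq_eq_integral]
    have h0 : (0 : ℝ) = ∫ _, (0 : ℝ) ∂μ := by simp
    rw [h0]
    refine tendsto_integral_of_dominated_convergence (fun x => h x ^ 2)
      (fun k => (Lp.aestronglyMeasurable _).pow 2) (Lp.memLp h).integrable_sq (fun k => ?_) ?_
    · filter_upwards [ht k, Lp.coeFn_sub (t k) h] with x hx hx'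
      rw [hx', Pi.sub_apply, hx, Real.norm_of_nonneg (sq_nonneg _)]
      by_cases hxa : x ∈ {x | |a x| ≤ k}
      · simp [Set.indicator_of_mem hxa, sq_nonneg]
      · simp [Set.indicator_of_notMem hxa]
    · filter_upwards [ae_all_iff.2 ht, ae_all_iff.2 fun k => Lp.coeFn_sub (t k) h] with x hx hx'
      refine tendsto_const_nhds.congr' ?_
      filter_upwards [eventually_ge_atTop ⌈|a x|⌉₊] with k hk
      have hxa : x ∈ {x | |a x| ≤ k} := (Nat.le_ceil _).trans (Nat.cast_le.2 hk)
      rw [hx' k, Pi.sub_apply, hx k, Set.indicator_of_mem hxa]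
      simp
  simpa using h1.sqrt

variable [IsProbabilityMeasure μ]

lemma integral_condInner (hn : n ≤ mX) (f h : Lp ℝ 2 μ) :
    ∫ x, condInner n f h x ∂μ = inner ℝ f h := by
  rw [inner_eq_integral_mul]
  exact integral_condExp hn

lemma setIntegral_condInner (hn : n ≤ mX) (f h : Lp ℝ 2 μ) {s : Set X} (hs : MeasurableSet[n] s) :
    ∫ x in s, condInner n f h x ∂μ = ∫ x in s, f x * h x ∂μ :=
  setIntegral_condExp hn (integrable_mul_Lp f h) hs

/-- The product of `v ∈ L²` with an unbounded `n`-measurable function `a` is in `L²` as soon as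
`a² 𝔼(v² | n)` is integrable. -/
lemma exists_mul_of_integrable (hn : n ≤ mX) {a : X → ℝ} (ha : StronglyMeasurable[n] a)
    (v : Lp ℝ 2 μ) (hint : Integrable (fun x => a x ^ 2 * condInner n v v x) μ) :
    ∃ h : Lp ℝ 2 μ, h =ᵐ[μ] fun x => a x * v x := by
  let b : ℕ → X → ℝ := fun k => {x | |a x| ≤ k}.indicator a
  have hb : ∀ k, StronglyMeasurable[n] (b k) := fun k => ha.indicator (measurableSet_abs_le ha k)
  have hbk : ∀ k x, |b k x| ≤ k := by
    intro k x
    by_cases hx : x ∈ {x | |a x| ≤ k}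
    · simpa only [b, Set.indicator_of_mem hx, Set.mem_ofPred_eq] using hx
    · simp [b, Set.indicator_of_notMem hx]
  have hba : ∀ k x, b k x ^ 2 ≤ a x ^ 2 := by
    intro k x
    by_cases hx : x ∈ {x | |a x| ≤ k}
    · simp [b, Set.indicator_of_mem hx]
    · simp [b, Set.indicator_of_notMem hx, sq_nonneg]
  have hv := (Lp.memLp v).integrable_sq
  have hvm : AEStronglyMeasurable (fun x => a x * v x) μ :=
    (ha.mono hn).aestronglyMeasurable.mul (Lp.aestronglyMeasurable v)
  have hI : ∀ k, Integrable (fun x => b k x ^ 2 * (v x * v x)) μ := fun k => by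
    refine (integrable_mul_Lp v v).bdd_mul (c := (k : ℝ) ^ 2)
      (((hb k).mono hn).pow 2).aestronglyMeasurable
      (Eventually.of_forall fun x => ?_)
    rw [Real.norm_eq_abs, abs_pow]
    exact pow_le_pow_left₀ (abs_nonneg _) (hbk k x) 2
  have hle : ∀ k, ∫ x, b k x ^ 2 * (v x * v x) ∂μ ≤ ∫ x, a x ^ 2 * condInner n v v x ∂μ := by
    intro k
    have h1 := condExp_mul_of_stronglyMeasurable_left (μ := μ) ((hb k).pow 2) (hI k)
      (integrable_mul_Lp v v)
    rw [← integral_condExp hn]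
    refine integral_mono_ae integrable_condExp hint ?_
    filter_upwards [h1, condInner_self_nonneg (n := n) v] with x hx h0
    exact (le_of_eq hx).trans (mul_le_mul_of_nonneg_right (hba k x) h0)
  have hmem : MemLp (fun x => a x * v x) 2 μ := by
    rw [memLp_two_iff_integrable_sq hvm]
    refine ⟨hvm.pow 2, ?_⟩
    -- Fatou's lemma for the truncations of `a`.
    have hlim : ∀ x, Tendsto (fun k => b k x ^ 2 * (v x * v x)) atTop (𝓝 ((a x * v x) ^ 2)) := by
      intro x
      refine tendsto_const_nhds.congr' ?_
      filter_upwards [eventually_ge_atTop ⌈|a x|⌉₊] with k hk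
      have hx : x ∈ {x | |a x| ≤ k} := (Nat.le_ceil _).trans (Nat.cast_le.2 hk)
      simp only [b, Set.indicator_of_mem hx]
      ring
    have h2 := lintegral_liminf_le' (μ := μ) (u := atTop)
      (f := fun k x => ‖b k x ^ 2 * (v x * v x)‖ₑ)
      fun k => (hI k).aestronglyMeasurable.enorm
    have h3 : ∀ x, liminf (fun k => ‖b k x ^ 2 * (v x * v x)‖ₑ) atTop = ‖(a x * v x) ^ 2‖ₑ :=
      fun x => (hlim x).enorm.liminf_eq
    simp only [h3] at h2
    refine lt_of_le_of_lt h2 (lt_of_le_of_lt (liminf_le_of_le (by isBoundedDefault)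
      (a := ENNReal.ofReal (∫ x, a x ^ 2 * condInner n v v x ∂μ)) fun c hc => ?_)
      ENNReal.ofReal_lt_top)
    obtain ⟨k, hk⟩ := hc.exists
    refine hk.trans ?_
    rw [← ofReal_integral_norm_eq_lintegral_enorm (hI k)]
    refine ENNReal.ofReal_le_ofReal (le_trans (le_of_eq ?_) (hle k))
    refine integral_congr_ae (Eventually.of_forall fun x => ?_)
    exact Real.norm_of_nonneg (mul_nonneg (sq_nonneg _) (mul_self_nonneg _))
  exact ⟨hmem.toLp _, hmem.coeFn_toLp⟩

lemma exists_mul_of_bounded (hn : n ≤ mX) {a : X → ℝ} (ha : StronglyMeasurable[n] a) {C : ℝ}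
    (hC : ∀ x, |a x| ≤ C) (v : Lp ℝ 2 μ) : ∃ h : Lp ℝ 2 μ, h =ᵐ[μ] fun x => a x * v x := by
  refine exists_mul_of_integrable hn ha v ((integrable_condInner v v).bdd_mul (c := C ^ 2)
    ((ha.mono hn).pow 2).aestronglyMeasurable (Eventually.of_forall fun x => ?_))
  rw [Real.norm_eq_abs, abs_pow]
  exact pow_le_pow_left₀ (abs_nonneg _) (hC x) 2

/-! ### Closed modules over a sub-σ-algebra -/

/-- A closed subspace of `L²` that is stable under multiplication by bounded functions measurable
for the sub-σ-algebra `n`. -/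
structure IsClosedModule (n : MeasurableSpace X) {mX : MeasurableSpace X} {μ : Measure X}
    (M : Submodule ℝ (Lp ℝ 2 μ)) : Prop where
  isClosed : IsClosed (M : Set (Lp ℝ 2 μ))
  mul_mem_of_bounded : ∀ (a : X → ℝ) (C : ℝ), StronglyMeasurable[n] a → (∀ x, |a x| ≤ C) →
    ∀ h ∈ M, ∀ h' : Lp ℝ 2 μ, (h' =ᵐ[μ] fun x => a x * h x) → h' ∈ M

/-- Closed modules are stable under unbounded multipliers, as long as the product is in `L²`. -/
lemma IsClosedModule.mul_mem (hn : n ≤ mX) {M : Submodule ℝ (Lp ℝ 2 μ)} (hM : IsClosedModule n M)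
    {a : X → ℝ} (ha : StronglyMeasurable[n] a) {h h' : Lp ℝ 2 μ} (hh : h ∈ M)
    (hh' : h' =ᵐ[μ] fun x => a x * h x) : h' ∈ M := by
  have hb : ∀ k : ℕ, StronglyMeasurable[n] ({x | |a x| ≤ k}.indicator a) :=
    fun k => ha.indicator (measurableSet_abs_le ha k)
  have hbk : ∀ (k : ℕ) x, |{x | |a x| ≤ k}.indicator a x| ≤ k := by
    intro k x
    by_cases hx : x ∈ {x | |a x| ≤ k}
    · simpa only [Set.indicator_of_mem hx, Set.mem_ofPred_eq] using hx
    · simp [Set.indicator_of_notMem hx]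
  choose t ht using fun k : ℕ => exists_mul_of_bounded hn (hb k) (hbk k) h
  refine hM.isClosed.mem_of_tendsto (tendsto_truncation (a := a) h' t fun k => ?_)
    (Eventually.of_forall fun k => hM.mul_mem_of_bounded _ k (hb k) (hbk k) h hh _ (ht k))
  filter_upwards [ht k, hh'] with x h1 h2
  rw [h1]
  by_cases hx : x ∈ {x | |a x| ≤ k}
  · simp only [Set.indicator_of_mem hx, h2]
  · simp only [Set.indicator_of_notMem hx, zero_mul]

/-- Vectors orthogonal to a closed module are orthogonal to it conditionally on `n`. -/
lemma IsClosedModule.condInner_eq_zero (hn : n ≤ mX) {M : Submodule ℝ (Lp ℝ 2 μ)}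
    (hM : IsClosedModule n M) {w e : Lp ℝ 2 μ} (hw : w ∈ Mᗮ) (he : e ∈ M) :
    condInner n w e =ᵐ[μ] 0 := by
  have hae : condInner n w e =ᵐ[μ.trim hn] 0 := by
    refine ae_eq_zero_of_forall_setIntegral_eq_of_sigmaFinite (μ := μ.trim hn)
      (fun s hs _ => ((integrable_condInner w e).trim hn
        (stronglyMeasurable_condInner w e)).integrableOn) fun s hs _ => ?_
    rw [← setIntegral_trim hn (stronglyMeasurable_condInner w e) hs,
      setIntegral_condInner hn w e hs]
    obtain ⟨e', he'⟩ := exists_mul_of_bounded hn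
      ((@stronglyMeasurable_const X ℝ n _ (1 : ℝ)).indicator hs) (C := 1) (fun x => by
        by_cases hx : x ∈ s <;> simp [hx]) e
    have h1 : e' ∈ M :=
      hM.mul_mem hn ((@stronglyMeasurable_const X ℝ n _ (1 : ℝ)).indicator hs) he he'
    have h2 : inner ℝ w e' = 0 := Submodule.inner_left_of_mem_orthogonal h1 hw
    rw [← h2, inner_eq_integral_mul, ← integral_indicator (hn s hs)]
    refine integral_congr_ae ?_
    filter_upwards [he'] with x hx
    by_cases hxs : x ∈ s <;> simp [hx, hxs]
  exact ae_eq_of_ae_eq_trim hae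

lemma IsClosedModule.orthogonal (hn : n ≤ mX) {M : Submodule ℝ (Lp ℝ 2 μ)}
    (hM : IsClosedModule n M) : IsClosedModule n Mᗮ := by
  refine ⟨M.isClosed_orthogonal, fun a C ha _ w hw w' hw' => ?_⟩
  rw [Submodule.mem_orthogonal']
  intro e he
  rw [← integral_condInner hn]
  refine integral_eq_zero_of_ae ?_
  filter_upwards [condInner_mul_left ha hw' e, hM.condInner_eq_zero hn hw he] with x h1 h2
  simp [h1, h2]

end CondInner

/-! ### Conditionally bounded vectors -/

section Frames

variable {X : Type*} {n mX : MeasurableSpace X} {μ : Measure X} [IsProbabilityMeasure μ]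

/-- A vector whose conditional second moment is bounded by `C²`. Every bounded function is
conditionally bounded; conditionally normalised vectors are so too, but need not be bounded. -/
def IsCondBounded (n : MeasurableSpace X) {mX : MeasurableSpace X} {μ : Measure X} (C : ℝ)
    (w : Lp ℝ 2 μ) : Prop :=
  ∀ᵐ x ∂μ, condInner n w w x ≤ C ^ 2

/-- For a conditionally bounded `w`, the conditional inner product with `w` is a bounded operator
on `L²`. -/
lemma exists_condInnerL (hn : n ≤ mX) {C : ℝ} (hC : 0 ≤ C) {w : Lp ℝ 2 μ}
    (hw : IsCondBounded n C w) :
    ∃ D : Lp ℝ 2 μ →L[ℝ] Lp ℝ 2 μ, (∀ φ, D φ =ᵐ[μ] condInner n w φ) ∧ ∀ φ, ‖D φ‖ ≤ C * ‖φ‖ := by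
  have hle : ∀ φ : Lp ℝ 2 μ, ∀ᵐ x ∂μ, condInner n w φ x ^ 2 ≤ C ^ 2 * condInner n φ φ x := by
    intro φ
    filter_upwards [hw, condInner_sq_le (n := n) w φ, condInner_self_nonneg (n := n) φ]
      with x h1 h2 h3
    exact h2.trans (mul_le_mul_of_nonneg_right h1 h3)
  have hm : ∀ φ : Lp ℝ 2 μ, AEStronglyMeasurable (condInner n w φ) μ := fun φ =>
    (integrable_condInner w φ).aestronglyMeasurable
  have hmem : ∀ φ : Lp ℝ 2 μ, MemLp (condInner n w φ) 2 μ := by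
    intro φ
    rw [memLp_two_iff_integrable_sq (hm φ)]
    refine Integrable.mono' ((integrable_condInner (n := n) φ φ).const_mul (C ^ 2))
      ((hm φ).pow 2) ?_
    filter_upwards [hle φ] with x hx
    rwa [Real.norm_of_nonneg (sq_nonneg _)]
  have hnorm : ∀ φ : Lp ℝ 2 μ, ‖(hmem φ).toLp‖ ≤ C * ‖φ‖ := by
    intro φ
    refine abs_le_of_sq_le_sq' ?_ (by positivity) |>.2
    rw [norm_sq_eq_integral, mul_pow, ← real_inner_self_eq_norm_sq φ, ← integral_condInner hn,
      ← integral_const_mul]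
    refine integral_mono_ae (Lp.memLp _).integrable_sq
      ((integrable_condInner φ φ).const_mul (C ^ 2)) ?_
    filter_upwards [hle φ, (hmem φ).coeFn_toLp] with x h1 h2
    rwa [h2]
  let D : Lp ℝ 2 μ →ₗ[ℝ] Lp ℝ 2 μ :=
    { toFun := fun φ => (hmem φ).toLp
      map_add' := fun φ ψ => by
        rw [← MemLp.toLp_add]
        exact MemLp.toLp_congr _ _ (condInner_add_right w φ ψ)
      map_smul' := fun c φ => by
        rw [RingHom.id_apply, ← MemLp.toLp_const_smul]
        exact MemLp.toLp_congr _ _ (condInner_smul_right c w φ) }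
  exact ⟨D.mkContinuous C hnorm, fun φ => (hmem φ).coeFn_toLp, hnorm⟩

/-- Multiplication by a bounded function that is measurable for `n`, as a bounded operator. -/
lemma exists_mulL (hn : n ≤ mX) {a : X → ℝ} (ha : StronglyMeasurable[n] a) {C : ℝ}
    (hC : ∀ x, |a x| ≤ C) :
    ∃ L : Lp ℝ 2 μ →L[ℝ] Lp ℝ 2 μ, ∀ φ, L φ =ᵐ[μ] fun x => a x * φ x := by
  choose L hL using exists_mul_of_bounded (μ := μ) hn ha hC
  let L' : Lp ℝ 2 μ →ₗ[ℝ] Lp ℝ 2 μ :=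
    { toFun := L
      map_add' := fun φ ψ => by
        refine Lp.ext ?_
        filter_upwards [hL (φ + ψ), hL φ, hL ψ, Lp.coeFn_add φ ψ, Lp.coeFn_add (L φ) (L ψ)]
          with x h1 h2 h3 h4 h5
        rw [h1, h5, Pi.add_apply, h2, h3, h4, Pi.add_apply, mul_add]
      map_smul' := fun c φ => by
        refine Lp.ext ?_
        filter_upwards [hL (c • φ), hL φ, Lp.coeFn_smul c φ, Lp.coeFn_smul c (L φ)]
          with x h1 h2 h3 h4
        rw [RingHom.id_apply, h1, h4, Pi.smul_apply, h2, h3, Pi.smul_apply, smul_eq_mul,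
          smul_eq_mul]
        ring }
  refine ⟨L'.mkContinuous C fun φ => Lp.norm_le_mul_norm_of_ae_le_mul ?_, hL⟩
  filter_upwards [hL φ] with x hx
  change ‖L φ x‖ ≤ _
  rw [hx, norm_mul]
  exact mul_le_mul_of_nonneg_right (hC x) (norm_nonneg _)

lemma stronglyMeasurable_indicator_one {s : Set X} (hs : MeasurableSet[n] s) :
    StronglyMeasurable[n] (s.indicator (1 : X → ℝ)) :=
  (@stronglyMeasurable_one X ℝ n _ _).indicator hs

lemma abs_indicator_one_le (s : Set X) (x : X) : |s.indicator (1 : X → ℝ) x| ≤ 1 := by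
  by_cases hx : x ∈ s <;> simp [hx]

lemma eq_zero_of_condInner_self (hn : n ≤ mX) {w : Lp ℝ 2 μ}
    (h : condInner n w w =ᵐ[μ] 0) : w = 0 := by
  rw [← inner_self_eq_zero (𝕜 := ℝ), ← integral_condInner hn]
  exact integral_eq_zero_of_ae h

lemma ae_eq_zero_of_condInner_self (hn : n ≤ mX) {w : Lp ℝ 2 μ} {s : Set X}
    (hs : MeasurableSet[n] s) (h : ∀ᵐ x ∂μ, x ∈ s → condInner n w w x = 0) :
    ∀ᵐ x ∂μ, x ∈ s → w x = 0 := by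
  obtain ⟨w', hw'⟩ := exists_mul_of_bounded hn (stronglyMeasurable_indicator_one hs)
    (abs_indicator_one_le s) w
  have h0 : w' = 0 := eq_zero_of_condInner_self hn <| by
    filter_upwards [condInner_mul_mul (stronglyMeasurable_indicator_one hs) hw', h] with x h1 h2
    by_cases hx : x ∈ s <;> simp [h1, hx, h2]
  filter_upwards [hw', Lp.coeFn_zero ℝ 2 μ] with x h1 h2 hx
  rw [h0, h2] at h1
  simpa [hx] using h1.symm

lemma condInner_self_eq_zero_of_ae {w : Lp ℝ 2 μ} {s : Set X}
    (hs : MeasurableSet[n] s) (h : ∀ᵐ x ∂μ, x ∈ s → w x = 0) :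
    ∀ᵐ x ∂μ, x ∈ s → condInner n w w x = 0 := by
  have h0 : (0 : Lp ℝ 2 μ) =ᵐ[μ] fun x => s.indicator (1 : X → ℝ) x * w x := by
    filter_upwards [h, Lp.coeFn_zero ℝ 2 μ] with x h1 h2
    rw [h2]
    by_cases hx : x ∈ s <;> simp [hx, h1]
  filter_upwards [condInner_mul_right (stronglyMeasurable_indicator_one hs) h0 w,
    condInner_zero_right (n := n) w] with x h1 h2 hx
  rw [h2] at h1
  simpa [hx] using h1.symm

/-! ### Conditionally orthonormal frames -/

/-- The vectors `u i` are conditionally orthogonal over `n`, and `u i` is conditionally normalised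
over the set `B i` and vanishes outside of it. -/
structure IsFrame (n : MeasurableSpace X) {mX : MeasurableSpace X} {μ : Measure X} {ι : Type*}
    (u : ι → Lp ℝ 2 μ) (B : ι → Set X) : Prop where
  measurableSet : ∀ i, MeasurableSet[n] (B i)
  condInner_self : ∀ i, condInner n (u i) (u i) =ᵐ[μ] (B i).indicator 1
  condInner_eq_zero : ∀ i j, i ≠ j → condInner n (u i) (u j) =ᵐ[μ] 0

lemma IsFrame.isCondBounded {ι : Type*} {u : ι → Lp ℝ 2 μ} {B : ι → Set X} (hu : IsFrame n u B)
    (i : ι) : IsCondBounded n 1 (u i) := by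
  filter_upwards [hu.condInner_self i] with x hx
  rw [hx, one_pow]
  exact (le_abs_self _).trans (abs_indicator_one_le _ x)

/-- The conditional projection to the module spanned by a frame, with Parseval's identity. -/
lemma IsFrame.exists_projection (hn : n ≤ mX) {ι : Type*} [Fintype ι] {u : ι → Lp ℝ 2 μ}
    {B : ι → Set X} (hu : IsFrame n u B) (w : Lp ℝ 2 μ) :
    ∃ p : ι → Lp ℝ 2 μ, (∀ i, p i =ᵐ[μ] fun x => condInner n (u i) w x * u i x) ∧
      (∀ i, condInner n (u i) (w - ∑ j, p j) =ᵐ[μ] 0) ∧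
      condInner n (w - ∑ j, p j) (w - ∑ j, p j) =ᵐ[μ]
        fun x => condInner n w w x - ∑ i, condInner n (u i) w x ^ 2 := by
  classical
  have hsm : ∀ i, StronglyMeasurable[n] (condInner n (u i) w) := fun i =>
    stronglyMeasurable_condInner (u i) w
  have hvanish : ∀ i, ∀ᵐ x ∂μ, condInner n (u i) w x * (B i).indicator 1 x =
      condInner n (u i) w x := by
    intro i
    filter_upwards [condInner_sq_le (n := n) (u i) w, hu.condInner_self i] with x h1 h2
    by_cases hx : x ∈ B i
    · simp [hx]
    · rw [h2, Set.indicator_of_notMem hx, zero_mul] at h1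
      have : condInner n (u i) w x = 0 := by nlinarith [sq_nonneg (condInner n (u i) w x)]
      simp [this]
  have hex : ∀ i, ∃ h : Lp ℝ 2 μ, h =ᵐ[μ] fun x => condInner n (u i) w x * u i x := by
    intro i
    refine exists_mul_of_integrable hn (hsm i) (u i) ?_
    refine Integrable.mono' (integrable_condInner (n := n) w w)
      (((((hsm i).mono hn).pow 2).mul
        ((stronglyMeasurable_condInner _ _).mono hn)).aestronglyMeasurable) ?_
    filter_upwards [condInner_sq_le (n := n) (u i) w, hu.condInner_self i,
      condInner_self_nonneg (n := n) w] with x h1 h2 h3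
    rw [h2] at h1 ⊢
    by_cases hx : x ∈ B i
    · simp only [Set.indicator_of_mem hx, Pi.one_apply, one_mul, mul_one] at h1 ⊢
      rwa [Real.norm_of_nonneg (sq_nonneg _)]
    · simpa [Set.indicator_of_notMem hx] using h3
  choose p hp using hex
  have hup : ∀ i, condInner n (u i) (∑ j, p j) =ᵐ[μ] condInner n (u i) w := by
    intro i
    have h1 : ∀ j, ∀ᵐ x ∂μ, condInner n (u i) (p j) x =
        if j = i then condInner n (u i) w x else 0 := by
      intro j
      by_cases hji : j = i
      · subst hji
        filter_upwards [condInner_mul_right (hsm j) (hp j) (u j), hu.condInner_self j, hvanish j]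
          with x h1 h2 h3
        rw [h1, h2, h3, if_pos rfl]
      · filter_upwards [condInner_mul_right (hsm j) (hp j) (u i),
          hu.condInner_eq_zero i j (Ne.symm hji)] with x h1 h2
        rw [h1, h2, if_neg hji]
        simp
    filter_upwards [ae_all_iff.2 h1, condInner_sum_right (n := n) Finset.univ (u i) p]
      with x h2 h3
    simp [h3, h2]
  have huz : ∀ i, condInner n (u i) (w - ∑ j, p j) =ᵐ[μ] 0 := by
    intro i
    filter_upwards [hup i, condInner_sub_right (n := n) (u i) w (∑ j, p j)] with x h1 h2
    rw [h2, h1, sub_self, Pi.zero_apply]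
  refine ⟨p, hp, huz, ?_⟩
  set w' := w - ∑ j, p j with hw'
  have h1 : ∀ i, condInner n w' (p i) =ᵐ[μ] 0 := by
    intro i
    filter_upwards [condInner_mul_right (hsm i) (hp i) w', huz i] with x h1 h2
    rw [h1, condInner_comm w', h2]
    simp
  have h2 : ∀ i, ∀ᵐ x ∂μ, condInner n w (p i) x = condInner n (u i) w x ^ 2 := by
    intro i
    filter_upwards [condInner_mul_right (hsm i) (hp i) w] with x h1
    rw [h1, condInner_comm w, sq]
  filter_upwards [condInner_sub_right (n := n) w' w (∑ j, p j),
    condInner_sub_right (n := n) w w (∑ j, p j), condInner_sum_right (n := n) Finset.univ w' p,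
    condInner_sum_right (n := n) Finset.univ w p, ae_all_iff.2 h1, ae_all_iff.2 h2]
    with x e1 e2 e3 e4 e5 e6
  rw [condInner_comm w' w] at e1
  rw [← hw'] at e1 e2
  rw [e1, e3, e2, e4]
  simp [e5, e6]

/-- Bessel's inequality over `n`. -/
lemma IsFrame.sum_sq_le (hn : n ≤ mX) {ι : Type*} [Fintype ι] {u : ι → Lp ℝ 2 μ}
    {B : ι → Set X} (hu : IsFrame n u B) (w : Lp ℝ 2 μ) :
    ∀ᵐ x ∂μ, ∑ i, condInner n (u i) w x ^ 2 ≤ condInner n w w x := by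
  obtain ⟨p, -, -, hp⟩ := hu.exists_projection hn w
  filter_upwards [hp, condInner_self_nonneg (n := n) (w - ∑ j, p j)] with x h1 h2
  rw [h1] at h2
  simpa using h2

/-- Every `v ∈ L²` is a multiple `b u` of a conditionally normalised vector `u = a v`, with
coefficients `a`, `b` that are measurable for `n` but possibly unbounded. -/
lemma exists_normalized (hn : n ≤ mX) (v : Lp ℝ 2 μ) :
    ∃ (u : Lp ℝ 2 μ) (B : Set X) (a b : X → ℝ), MeasurableSet[n] B ∧ StronglyMeasurable[n] a ∧
      StronglyMeasurable[n] b ∧ (u =ᵐ[μ] fun x => a x * v x) ∧ (v =ᵐ[μ] fun x => b x * u x) ∧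
      condInner n u u =ᵐ[μ] B.indicator 1 := by
  set q : X → ℝ := condInner n v v with hq
  have hqm : StronglyMeasurable[n] q := stronglyMeasurable_condInner v v
  have hb : StronglyMeasurable[n] fun x => Real.sqrt (q x) :=
    Real.continuous_sqrt.comp_stronglyMeasurable hqm
  have ha : StronglyMeasurable[n] fun x => (Real.sqrt (q x))⁻¹ :=
    (hb.measurable.inv).stronglyMeasurable
  set B : Set X := {x | 0 < q x} with hB
  have hBm : MeasurableSet[n] B := hqm.measurable measurableSet_Ioi
  have haq : ∀ᵐ x ∂μ, (Real.sqrt (q x))⁻¹ ^ 2 * q x = B.indicator 1 x := by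
    filter_upwards [condInner_self_nonneg (n := n) v] with x hx
    by_cases hxB : x ∈ B
    · have : 0 < q x := hxB
      rw [Set.indicator_of_mem hxB, inv_pow, Real.sq_sqrt hx, Pi.one_apply,
        inv_mul_cancel₀ this.ne']
    · have : q x = 0 := le_antisymm (not_lt.1 hxB) hx
      simp [Set.indicator_of_notMem hxB, this]
  obtain ⟨u, hu⟩ := exists_mul_of_integrable hn ha v <| by
    refine Integrable.congr (f := B.indicator 1) ?_ (haq.mono fun x hx => hx.symm)
    exact (integrable_const (1 : ℝ)).indicator (hn _ hBm)
  refine ⟨u, B, _, _, hBm, ha, hb, hu, ?_, (condInner_mul_mul ha hu).trans haq⟩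
  have hv0 := ae_eq_zero_of_condInner_self hn (w := v) (s := Bᶜ) hBm.compl <| by
    filter_upwards [condInner_self_nonneg (n := n) v] with x hx hxB
    exact le_antisymm (not_lt.1 hxB) hx
  filter_upwards [hu, hv0] with x h1 h2
  rw [h1]
  by_cases hxB : x ∈ B
  · have : 0 < Real.sqrt (q x) := Real.sqrt_pos.2 hxB
    field_simp
  · simp [h2 hxB]

/-! ### Closed modules of finite rank -/

/-- The vectors that are conditionally orthogonal to all `u i`; a closed module when the `u i` are
conditionally bounded. -/
def condOrthogonal (n : MeasurableSpace X) {mX : MeasurableSpace X} {μ : Measure X} {ι : Type*}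
    (u : ι → Lp ℝ 2 μ) : Submodule ℝ (Lp ℝ 2 μ) where
  carrier := {w | ∀ i, condInner n (u i) w =ᵐ[μ] 0}
  zero_mem' i := condInner_zero_right (u i)
  add_mem' {v w} hv hw i := by
    filter_upwards [condInner_add_right (n := n) (u i) v w, hv i, hw i] with x h1 h2 h3
    simp [h1, h2, h3]
  smul_mem' c w hw i := by
    filter_upwards [condInner_smul_right (n := n) c (u i) w, hw i] with x h1 h2
    simp [h1, h2]

lemma isClosedModule_condOrthogonal (hn : n ≤ mX) {ι : Type*} {u : ι → Lp ℝ 2 μ} {C : ℝ}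
    (hC : 0 ≤ C) (hu : ∀ i, IsCondBounded n C (u i)) : IsClosedModule n (condOrthogonal n u) := by
  refine ⟨?_, fun a _ ha _ w hw w' hw' i => ?_⟩
  · choose D hD _ using fun i => exists_condInnerL hn hC (hu i)
    have : (condOrthogonal n u : Set (Lp ℝ 2 μ)) = ⋂ i, {w | D i w = 0} := by
      ext w
      rw [Set.mem_iInter]
      refine forall_congr' fun i => ?_
      change condInner n (u i) w =ᵐ[μ] 0 ↔ D i w = 0
      rw [Lp.eq_zero_iff_ae_eq_zero]
      exact ⟨(hD i w).trans, (hD i w).symm.trans⟩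
    rw [this]
    exact isClosed_iInter fun i => isClosed_eq (D i).continuous continuous_const
  · filter_upwards [condInner_mul_right ha hw' (u i), hw i] with x h1 h2
    simp [h1, h2]

lemma IsClosedModule.inf {M N : Submodule ℝ (Lp ℝ 2 μ)} (hM : IsClosedModule n M)
    (hN : IsClosedModule n N) : IsClosedModule n (M ⊓ N) :=
  ⟨hM.isClosed.inter hN.isClosed, fun a C ha hC h hh h' hh' =>
    ⟨hM.mul_mem_of_bounded a C ha hC h hh.1 h' hh', hN.mul_mem_of_bounded a C ha hC h hh.2 h' hh'⟩⟩

/-- `M` is contained in the closed module generated by the vectors `φ i`. -/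
def GeneratedBy (n : MeasurableSpace X) {mX : MeasurableSpace X} {μ : Measure X} {ι : Type*}
    (φ : ι → Lp ℝ 2 μ) (M : Submodule ℝ (Lp ℝ 2 μ)) : Prop :=
  ∀ N : Submodule ℝ (Lp ℝ 2 μ), IsClosedModule n N → (∀ i, φ i ∈ N) → M ≤ N

/-- `M` has rank at most `d` over `n`: it has no conditionally orthonormal family of `d + 1` vectors
over a set of positive measure. This condition clearly passes to submodules. -/
def RankLE (n : MeasurableSpace X) {mX : MeasurableSpace X} {μ : Measure X} (d : ℕ)
    (M : Submodule ℝ (Lp ℝ 2 μ)) : Prop :=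
  ∀ (B : Set X) (u : Fin (d + 1) → Lp ℝ 2 μ), (∀ i, u i ∈ M) → IsFrame n u (fun _ => B) → μ B = 0

lemma RankLE.mono {d : ℕ} {M N : Submodule ℝ (Lp ℝ 2 μ)} (h : RankLE n d N) (hMN : M ≤ N) :
    RankLE n d M :=
  fun B u hu hB => h B u (fun i => hMN (hu i)) hB

/-- Parseval's identity for a module generated by a frame. -/
lemma IsFrame.eq_sum_of_generatedBy (hn : n ≤ mX) {ι : Type*} [Fintype ι] {u : ι → Lp ℝ 2 μ}
    {B : ι → Set X} (hu : IsFrame n u B) {M : Submodule ℝ (Lp ℝ 2 μ)} (hM : GeneratedBy n u M)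
    {h : Lp ℝ 2 μ} (hh : h ∈ M) :
    (h =ᵐ[μ] fun x => ∑ i, condInner n (u i) h x * u i x) ∧
      condInner n h h =ᵐ[μ] fun x => ∑ i, condInner n (u i) h x ^ 2 := by
  obtain ⟨p, hp, hpu, hpp⟩ := hu.exists_projection hn h
  have hU : IsClosedModule n (condOrthogonal n u) :=
    isClosedModule_condOrthogonal hn zero_le_one hu.isCondBounded
  have hU' := hU.orthogonal hn
  have hui : ∀ i, u i ∈ (condOrthogonal n u)ᗮ := by
    intro i
    rw [Submodule.mem_orthogonal']
    intro w hw
    rw [← integral_condInner hn]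
    exact integral_eq_zero_of_ae (hw i)
  have h1 : h - ∑ j, p j ∈ (condOrthogonal n u)ᗮ :=
    Submodule.sub_mem _ (hM _ hU' hui hh) (Submodule.sum_mem _ fun i _ =>
      hU'.mul_mem hn (stronglyMeasurable_condInner _ _) (hui i) (hp i))
  have h0 : h - ∑ j, p j = 0 :=
    inner_self_eq_zero.1 (Submodule.inner_right_of_mem_orthogonal (𝕜 := ℝ)
      (show h - ∑ j, p j ∈ condOrthogonal n u from hpu) h1)
  refine ⟨?_, ?_⟩
  · rw [sub_eq_zero] at h0
    filter_upwards [Lp.coeFn_fun_finsetSum Finset.univ p, ae_all_iff.2 hp] with x h2 h3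
    rw [h0] at *
    rw [h2]
    exact Finset.sum_congr rfl fun i _ => h3 i
  · rw [h0] at hpp
    filter_upwards [hpp, condInner_zero_right (n := n) (0 : Lp ℝ 2 μ)] with x h2 h3
    rw [h3, Pi.zero_apply] at h2
    linarith

/-- The Gram–Schmidt process over `n`. -/
lemma exists_frame_of_generators (hn : n ≤ mX) (d : ℕ) (φ : Fin d → Lp ℝ 2 μ) :
    ∃ (u : Fin d → Lp ℝ 2 μ) (B : Fin d → Set X), IsFrame n u B ∧
      ∀ N : Submodule ℝ (Lp ℝ 2 μ), IsClosedModule n N → (∀ i, u i ∈ N) → ∀ i, φ i ∈ N := by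
  induction d with
  | zero => exact ⟨φ, fun _ => ∅, ⟨fun i => i.elim0, fun i => i.elim0, fun i => i.elim0⟩,
      fun _ _ _ i => i.elim0⟩
  | succ d ih =>
    obtain ⟨u, B, hu, hgen⟩ := ih (Fin.tail φ)
    obtain ⟨p, hp, hpu, -⟩ := hu.exists_projection hn (φ 0)
    obtain ⟨u₀, B₀, a, b, hB₀, ha, hb, hua, hvb, hu₀⟩ := exists_normalized hn (φ 0 - ∑ j, p j)
    have h0 : ∀ i, condInner n (u i) u₀ =ᵐ[μ] 0 := by
      intro i
      filter_upwards [condInner_mul_right ha hua (u i), hpu i] with x h1 h2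
      simp [h1, h2]
    refine ⟨Fin.cons u₀ u, Fin.cons B₀ B, ⟨?_, ?_, ?_⟩, fun N hN hN' => ?_⟩
    · intro i
      refine Fin.cases hB₀ (fun i => hu.measurableSet i) i
    · intro i
      refine Fin.cases ?_ (fun i => ?_) i
      · simpa using hu₀
      · simpa using hu.condInner_self i
    · intro i j
      refine Fin.cases ?_ (fun i => ?_) i <;> refine Fin.cases ?_ (fun j => ?_) j <;> intro hij
      · exact absurd rfl hij
      · simpa [condInner_comm u₀] using h0 j
      · simpa using h0 i
      · simpa using hu.condInner_eq_zero i j (fun h => hij (congrArg Fin.succ h))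
    · have h1 : u₀ ∈ N := by simpa using hN' 0
      have h2 : ∀ i, u i ∈ N := fun i => by simpa using hN' i.succ
      intro i
      refine Fin.cases ?_ (fun i => ?_) i
      · have h3 : φ 0 - ∑ j, p j ∈ N := hN.mul_mem hn hb h1 hvb
        have h4 : ∑ j, p j ∈ N := Submodule.sum_mem _ fun i _ =>
          hN.mul_mem hn (stronglyMeasurable_condInner _ _) (h2 i) (hp i)
        simpa using Submodule.add_mem _ h3 h4
      · exact hgen N hN h2 i

/-- A module with `d` generators has rank at most `d`: for a conditionally orthonormal family `ψ`
over `B` and a generating frame `u`, the sum of all `𝔼(ψᵢ uⱼ | n)²` is `d + 1` on `B` by Parseval's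
identity for `u` and at most `d` by Bessel's inequality for `ψ`. -/
lemma rankLE_of_generatedBy (hn : n ≤ mX) {d : ℕ} {φ : Fin d → Lp ℝ 2 μ}
    {M : Submodule ℝ (Lp ℝ 2 μ)} (hM : GeneratedBy n φ M) : RankLE n d M := by
  intro B ψ hψM hψ
  obtain ⟨u, B', hu, hgen⟩ := exists_frame_of_generators hn d φ
  have hMu : GeneratedBy n u M := fun N hN hN' => hM N hN (hgen N hN hN')
  have h1 : ∀ i, ∀ᵐ x ∂μ, B.indicator 1 x = ∑ j, condInner n (u j) (ψ i) x ^ 2 := by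
    intro i
    filter_upwards [(hu.eq_sum_of_generatedBy hn hMu (hψM i)).2, hψ.condInner_self i] with x h1 h2
    rw [← h1, h2]
  have h2 : ∀ j, ∀ᵐ x ∂μ, ∑ i, condInner n (ψ i) (u j) x ^ 2 ≤ 1 := by
    intro j
    filter_upwards [hψ.sum_sq_le hn (u j), hu.isCondBounded j] with x h1 h2
    exact h1.trans (by simpa using h2)
  rw [measure_eq_zero_iff_ae_notMem]
  filter_upwards [ae_all_iff.2 h1, ae_all_iff.2 h2] with x h1 h2 hx
  have h3 : ∑ _i : Fin (d + 1), (1 : ℝ) ≤ ∑ _j : Fin d, (1 : ℝ) := by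
    calc ∑ _i : Fin (d + 1), (1 : ℝ) = ∑ i, ∑ j, condInner n (u j) (ψ i) x ^ 2 := by
          refine Finset.sum_congr rfl fun i _ => ?_
          rw [← h1 i, Set.indicator_of_mem hx, Pi.one_apply]
      _ = ∑ j, ∑ i, condInner n (u j) (ψ i) x ^ 2 := Finset.sum_comm
      _ ≤ ∑ _j : Fin d, (1 : ℝ) := Finset.sum_le_sum fun j _ => by
          simpa only [condInner_comm (u j)] using h2 j
  simp at h3
  linarith

variable [SecondCountableTopology (Lp ℝ 2 μ)]

/-- A closed module has a conditionally normalised vector of maximal support: normalise a dense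
sequence and glue the pieces along disjoint sets of `n`. -/
lemma IsClosedModule.exists_maximal_support (hn : n ≤ mX) {M : Submodule ℝ (Lp ℝ 2 μ)}
    (hM : IsClosedModule n M) :
    ∃ φ ∈ M, ∃ B : Set X, MeasurableSet[n] B ∧ condInner n φ φ =ᵐ[μ] B.indicator 1 ∧
      ∀ h ∈ M, ∀ᵐ x ∂μ, x ∉ B → h x = 0 := by
  obtain ⟨v, hv⟩ := TopologicalSpace.exists_dense_seq M
  choose u B a b hB ha hb hua hvb huB using fun k => exists_normalized hn (v k : Lp ℝ 2 μ)
  have huM : ∀ k, u k ∈ M := fun k => hM.mul_mem hn (ha k) (v k).2 (hua k)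
  have hu0 : ∀ k, ∀ᵐ x ∂μ, x ∉ B k → u k x = 0 := fun k =>
    ae_eq_zero_of_condInner_self hn (hB k).compl ((huB k).mono fun x h1 hx => by
      rw [h1, Set.indicator_of_notMem hx])
  -- `t k` is the restriction of `u k` to the part of `B k` not covered by the earlier `B j`.
  set C : ℕ → Set X := disjointed B with hC
  have hCm : ∀ k, MeasurableSet[n] (C k) := MeasurableSet.disjointed hB
  have hCB : ∀ k, C k ⊆ B k := disjointed_subset B
  have hCd : Pairwise (Function.onFun Disjoint C) := disjoint_disjointed B
  have hCU : ⋃ k, C k = ⋃ k, B k := iUnion_disjointed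
  choose L hL using fun k => exists_mulL (μ := μ) hn (stronglyMeasurable_indicator_one (hCm k))
    (abs_indicator_one_le (C k))
  set t : ℕ → Lp ℝ 2 μ := fun k => L k (u k) with ht
  have htM : ∀ k, t k ∈ M := fun k =>
    hM.mul_mem hn (stronglyMeasurable_indicator_one (hCm k)) (huM k) (hL k (u k))
  have htt : ∀ k, condInner n (t k) (t k) =ᵐ[μ] (C k).indicator 1 := by
    intro k
    filter_upwards [condInner_mul_mul (stronglyMeasurable_indicator_one (hCm k)) (hL k (u k)),
      huB k] with x h1 h2
    rw [h1, h2]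
    by_cases hx : x ∈ C k
    · simp [hx, hCB k hx]
    · simp [hx]
  have hmul0 : ∀ (s : Set X) (Ls : Lp ℝ 2 μ →L[ℝ] Lp ℝ 2 μ) (k : ℕ), Disjoint s (C k) →
      (∀ φ, Ls φ =ᵐ[μ] fun x => s.indicator 1 x * φ x) → Ls (t k) = 0 := by
    intro s Ls k hs hLs
    rw [Lp.eq_zero_iff_ae_eq_zero]
    filter_upwards [hLs (t k), hL k (u k)] with x h1 h2
    rw [h1, h2]
    by_cases hx : x ∈ s
    · simp [Set.disjoint_left.1 hs hx]
    · simp [hx]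
  have htorth : ∀ j k, j ≠ k → inner ℝ (t j) (t k) = 0 := by
    intro j k hjk
    rw [inner_eq_integral_mul]
    refine integral_eq_zero_of_ae ?_
    filter_upwards [hL j (u j), hL k (u k)] with x h1 h2
    rw [h1, h2]
    by_cases hx : x ∈ C j
    · simp [Set.disjoint_left.1 (hCd hjk) hx]
    · simp [hx]
  have hsum : Summable t := by
    have hort : OrthogonalFamily ℝ (fun k => (ℝ ∙ t k : Submodule ℝ (Lp ℝ 2 μ)))
        fun k => (ℝ ∙ t k).subtypeₗᵢ := by
      refine OrthogonalFamily.of_pairwise fun j k hjk => ?_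
      change (ℝ ∙ t j) ⟂ (ℝ ∙ t k)
      rw [Submodule.isOrtho_span]
      rintro _ rfl _ rfl
      exact htorth j k hjk
    refine (hort.summable_iff_norm_sq_summable
      fun k => ⟨t k, Submodule.mem_span_singleton_self _⟩).2 ?_
    have h1 : ∀ k, ‖t k‖ ^ 2 = μ.real (C k) := by
      intro k
      rw [← real_inner_self_eq_norm_sq, ← integral_condInner hn, integral_congr_ae (htt k),
        integral_indicator_one (hn _ (hCm k))]
    refine (summable_measure_toReal (μ := μ) (fun k => hn _ (hCm k)) hCd).congr fun k => ?_
    rw [← h1]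
    rfl
  have hBU : MeasurableSet[n] (⋃ k, B k) := MeasurableSet.iUnion hB
  obtain ⟨L', hL'⟩ := exists_mulL (μ := μ) hn (stronglyMeasurable_indicator_one hBU.compl)
    (abs_indicator_one_le (⋃ k, B k)ᶜ)
  have hφ := hsum.hasSum
  set φ := ∑' k, t k with hφdef
  -- Restricting `φ` to `C k` gives `t k`, and restricting it to the complement of all `B k` gives
  -- zero; this determines the conditional norm of `φ`.
  have hLφ : ∀ k, L k φ = t k := by
    intro k
    refine ((L k).hasSum hφ).unique ?_
    have h1 : L k (t k) = t k := by
      refine Lp.ext ?_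
      filter_upwards [hL k (t k), hL k (u k)] with x h1 h2
      rw [h1, h2]
      by_cases hx : x ∈ C k <;> simp [hx]
    have h2 := hasSum_single (f := fun j => L k (t j)) k fun j hj =>
      hmul0 (C k) (L k) j (hCd (Ne.symm hj)) (hL k)
    rwa [h1] at h2
  have hL'φ : L' φ = 0 := by
    refine (L'.hasSum hφ).unique ?_
    have h2 : (fun k => L' (t k)) = fun _ => 0 := funext fun k => hmul0 _ L' k
      (Set.disjoint_compl_left_iff_subset.2 ((hCB k).trans (Set.subset_iUnion B k))) hL'
    change HasSum (fun k => L' (t k)) 0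
    rw [h2]
    exact hasSum_zero
  refine ⟨φ, ?_, ⋃ k, B k, hBU, ?_, fun h hh => ?_⟩
  · exact hM.isClosed.mem_of_tendsto hφ
      (Eventually.of_forall fun s => Submodule.sum_mem _ fun k _ => htM k)
  · have h1 : ∀ k, ∀ᵐ x ∂μ, x ∈ C k → condInner n φ φ x = 1 := by
      intro k
      have h2 := condInner_mul_mul (stronglyMeasurable_indicator_one (hCm k)) (hL k φ)
      rw [hLφ] at h2
      filter_upwards [h2, htt k] with x h3 h4 hx
      rw [h4] at h3
      simpa [hx] using h3.symm
    have h2 := condInner_mul_mul (stronglyMeasurable_indicator_one hBU.compl) (hL' φ)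
    rw [hL'φ] at h2
    filter_upwards [ae_all_iff.2 h1, h2, condInner_zero_right (n := n) (0 : Lp ℝ 2 μ)]
      with x h3 h4 h5
    by_cases hx : x ∈ ⋃ k, B k
    · rw [Set.indicator_of_mem hx]
      rw [← hCU] at hx
      obtain ⟨k, hk⟩ := Set.mem_iUnion.1 hx
      exact h3 k hk
    · rw [h5] at h4
      rw [Set.indicator_of_notMem hx]
      have hx' : x ∈ (⋃ k, B k)ᶜ := hx
      rw [Set.indicator_of_mem hx'] at h4
      simpa using h4.symm
  · have hcl : IsClosed {h : M | L' h = 0} :=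
      isClosed_eq (L'.continuous.comp continuous_subtype_val) continuous_const
    have hsub : Set.range v ⊆ {h : M | L' h = 0} := by
      rintro _ ⟨k, rfl⟩
      change L' (v k) = 0
      rw [Lp.eq_zero_iff_ae_eq_zero]
      filter_upwards [hL' (v k), hvb k, hu0 k] with x h1 h2 h3
      rw [h1, h2]
      by_cases hx : x ∈ ⋃ k, B k
      · have hx' : x ∉ (⋃ k, B k)ᶜ := fun h => h hx
        rw [Set.indicator_of_notMem hx', zero_mul, Pi.zero_apply]
      · rw [h3 fun h => hx (Set.mem_iUnion.2 ⟨k, h⟩)]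
        simp
    have h0 : L' h = 0 := hcl.closure_subset_iff.2 hsub (hv ⟨h, hh⟩)
    filter_upwards [hL' h, Lp.coeFn_zero ℝ 2 μ] with x h1 h2 hx
    rw [h0, h2] at h1
    have hx' : x ∈ (⋃ k, B k)ᶜ := hx
    rw [Set.indicator_of_mem hx'] at h1
    simpa using h1.symm

/-- A closed module of rank at most `d` is generated by `d` vectors: split off a normalised vector
of maximal support and continue with its conditional orthogonal complement. -/
lemma IsClosedModule.exists_generators (hn : n ≤ mX) {d : ℕ} {M : Submodule ℝ (Lp ℝ 2 μ)}
    (hM : IsClosedModule n M) (hd : RankLE n d M) :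
    ∃ φ : Fin d → Lp ℝ 2 μ, (∀ i, φ i ∈ M) ∧ GeneratedBy n φ M := by
  induction d generalizing M with
  | zero =>
    refine ⟨fun i => i.elim0, fun i => i.elim0, fun N _ _ h hh => ?_⟩
    obtain ⟨φ, hφ, B, hB, hφB, hmax⟩ := hM.exists_maximal_support hn
    have hB0 : μ B = 0 := hd B (fun _ => φ) (fun _ => hφ)
      ⟨fun _ => hB, fun _ => hφB, fun i j hij => absurd (Subsingleton.elim (α := Fin 1) i j) hij⟩
    have : h = 0 := by
      rw [Lp.eq_zero_iff_ae_eq_zero]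
      filter_upwards [hmax h hh, measure_eq_zero_iff_ae_notMem.1 hB0] with x h1 h2 using h1 h2
    rw [this]
    exact N.zero_mem
  | succ d ih =>
    obtain ⟨φ, hφ, B, hB, hφB, hmax⟩ := hM.exists_maximal_support hn
    have hframe : IsFrame n (fun _ : Unit => φ) fun _ => B :=
      ⟨fun _ => hB, fun _ => hφB, fun i j hij => absurd rfl hij⟩
    have hU : IsClosedModule n (condOrthogonal n fun _ : Unit => φ) :=
      isClosedModule_condOrthogonal hn zero_le_one hframe.isCondBounded
    have hrank : RankLE n d (M ⊓ condOrthogonal n fun _ : Unit => φ) := by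
      intro B' ψ hψM hψ
      have hB' : MeasurableSet[n] B' := hψ.measurableSet 0
      -- By maximality of `B`, the family `ψ` lives on `B`, so `φ` restricted to `B'` extends it.
      have hBB' : ∀ᵐ x ∂μ, x ∈ B' → x ∈ B := by
        filter_upwards [condInner_self_eq_zero_of_ae hB.compl (hmax (ψ 0) (hψM 0).1),
          hψ.condInner_self 0] with x h1 h2 hx
        by_contra hxB
        rw [h1 hxB, Set.indicator_of_mem hx, Pi.one_apply] at h2
        exact zero_ne_one h2
      obtain ⟨φ', hφ'⟩ := exists_mul_of_bounded hn (stronglyMeasurable_indicator_one hB')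
        (abs_indicator_one_le B') φ
      have horth : ∀ i, condInner n φ' (ψ i) =ᵐ[μ] 0 := by
        intro i
        filter_upwards [condInner_mul_left (stronglyMeasurable_indicator_one hB') hφ' (ψ i),
          (hψM i).2 ()] with x h1 h2
        rw [h1, h2]
        simp
      refine hd B' (Fin.cons φ' ψ) (fun i => ?_) ⟨fun _ => hB', fun i => ?_, fun i j => ?_⟩
      · refine Fin.cases ?_ (fun i => ?_) i
        · exact hM.mul_mem hn (stronglyMeasurable_indicator_one hB') hφ hφ'
        · exact (hψM i).1
      · refine Fin.cases ?_ (fun i => ?_) i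
        · rw [Fin.cons_zero]
          filter_upwards [condInner_mul_mul (stronglyMeasurable_indicator_one hB') hφ', hφB, hBB']
            with x h1 h2 h3
          rw [h1, h2]
          by_cases hx : x ∈ B'
          · simp [hx, h3 hx]
          · simp [hx]
        · simpa using hψ.condInner_self i
      · refine Fin.cases ?_ (fun i => ?_) i <;> refine Fin.cases ?_ (fun j => ?_) j <;> intro hij
        · exact absurd rfl hij
        · simpa using horth j
        · simpa [condInner_comm (ψ i)] using horth i
        · simpa using hψ.condInner_eq_zero i j (fun h => hij (congrArg Fin.succ h))
    obtain ⟨φ', hφ'M, hgen⟩ := ih (hM.inf hU) hrank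
    refine ⟨Fin.cons φ φ', fun i => ?_, fun N hN hN' h hh => ?_⟩
    · refine Fin.cases hφ (fun i => (hφ'M i).1) i
    · have h1 : φ ∈ N := by simpa using hN' 0
      have h2 : ∀ i, φ' i ∈ N := fun i => by simpa using hN' i.succ
      obtain ⟨p, hp, hpu, -⟩ := hframe.exists_projection hn h
      have hpM : ∑ j, p j ∈ M := Submodule.sum_mem _ fun i _ =>
        hM.mul_mem hn (stronglyMeasurable_condInner _ _) hφ (hp i)
      have hpN : ∑ j, p j ∈ N := Submodule.sum_mem _ fun i _ =>
        hN.mul_mem hn (stronglyMeasurable_condInner _ _) h1 (hp i)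
      have h3 := hgen N hN h2 ⟨Submodule.sub_mem _ hh hpM, hpu⟩
      simpa using Submodule.add_mem _ h3 hpN

end Frames

/-! ### The Koopman operators -/

section Koopman

variable {G : Type*} [Group G] [MeasurableSpace G] {X : Type*} {n : MeasurableSpace X}
  [mX : MeasurableSpace X] [MulAction G X] [MeasurableSMul₂ G X] {μ : Measure X}
  [SMulInvariantMeasure G X μ]

/-- The Koopman operator as a linear isometry. -/
def koopmanLI (μ : Measure X) [SMulInvariantMeasure G X μ] (g : G) : Lp ℝ 2 μ →ₗᵢ[ℝ] Lp ℝ 2 μ :=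
  Lp.compMeasurePreservingₗᵢ ℝ (fun x : X => g • x) (measurePreserving_smul g μ)

lemma koopmanLI_apply (g : G) (f : Lp ℝ 2 μ) : koopmanLI μ g f = koopman μ g f := rfl

lemma koopman_ae (g : G) (f : Lp ℝ 2 μ) : koopman μ g f =ᵐ[μ] fun x => f (g • x) :=
  Lp.coeFn_compMeasurePreserving f (measurePreserving_smul g μ)

lemma ae_smul {p : X → Prop} (h : ∀ᵐ x ∂μ, p x) (g : G) : ∀ᵐ x ∂μ, p (g • x) :=
  (measurePreserving_smul g μ).quasiMeasurePreserving.ae h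

lemma koopman_koopman (g h : G) (f : Lp ℝ 2 μ) :
    koopman μ g (koopman μ h f) = koopman μ (h * g) f := by
  refine Lp.ext ?_
  filter_upwards [koopman_ae g (koopman μ h f), koopman_ae (h * g) f, ae_smul (koopman_ae h f) g]
    with x h1 h2 h3
  rw [h1, h2, h3, mul_smul]

lemma koopman_one (f : Lp ℝ 2 μ) : koopman μ (1 : G) f = f := by
  refine Lp.ext ?_
  filter_upwards [koopman_ae (1 : G) f] with x h1
  rw [h1, one_smul]

lemma inner_koopman (g : G) (f h : Lp ℝ 2 μ) :
    inner ℝ (koopman μ g f) (koopman μ g h) = inner ℝ f h :=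
  (koopmanLI μ g).inner_map_map f h

lemma norm_koopman (g : G) (f : Lp ℝ 2 μ) : ‖koopman μ g f‖ = ‖f‖ :=
  (koopmanLI μ g).norm_map f

variable [IsProbabilityMeasure μ]

/-- Conditional inner products over an invariant sub-σ-algebra are equivariant. -/
lemma condInner_koopman (hn : n ≤ mX) (hinv : ∀ g : G, @Measurable X X n n fun x => g • x) (g : G)
    (f h : Lp ℝ 2 μ) :
    condInner n (koopman μ g f) (koopman μ g h) =ᵐ[μ] fun x => condInner n f h (g • x) := by
  have hmp := measurePreserving_smul g μ
  have hcomp : ∀ F : X → ℝ, Integrable F μ → Integrable (fun x => F (g • x)) μ := fun F hF =>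
    hmp.integrable_comp_of_integrable hF
  refine (ae_eq_condExp_of_forall_setIntegral_eq hn (integrable_mul_Lp _ _)
    (fun s _ _ => (hcomp _ (integrable_condInner f h)).integrableOn) (fun s hs _ => ?_) ?_).symm
  · -- The set `s` is the preimage under `g` of its image under `g`.
    have hs' : MeasurableSet[n] ((fun x : X => g⁻¹ • x) ⁻¹' s) := hinv g⁻¹ hs
    have hss : s = (fun x : X => g • x) ⁻¹' ((fun x : X => g⁻¹ • x) ⁻¹' s) := by
      ext x; simp
    have he : MeasurableEmbedding fun x : X => g • x := measurableEmbedding_const_smul g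
    rw [hss, hmp.setIntegral_preimage_emb he (condInner n f h),
      setIntegral_condInner hn f h hs', ← hmp.setIntegral_preimage_emb he fun x => f x * h x]
    refine integral_congr_ae (ae_restrict_of_ae ?_)
    filter_upwards [koopman_ae g f, koopman_ae g h] with x h1 h2
    rw [h1, h2]
  · exact ((stronglyMeasurable_condInner f h).comp_measurable (hinv g)).aestronglyMeasurable

lemma IsCondBounded.koopman (hn : n ≤ mX) (hinv : ∀ g : G, @Measurable X X n n fun x => g • x)
    {C : ℝ} {f : Lp ℝ 2 μ} (hf : IsCondBounded n C f) (g : G) :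
    IsCondBounded n C (koopman μ g f) := by
  filter_upwards [condInner_koopman hn hinv g f f, ae_smul hf g] with x h1 h2
  rwa [h1]

lemma IsFrame.koopman (hn : n ≤ mX) (hinv : ∀ g : G, @Measurable X X n n fun x => g • x)
    {ι : Type*} {u : ι → Lp ℝ 2 μ} {B : ι → Set X} (hu : IsFrame n u B) (g : G) :
    IsFrame n (fun i => koopman μ g (u i)) fun i => (fun x => g • x) ⁻¹' B i := by
  refine ⟨fun i => hinv g (hu.measurableSet i), fun i => ?_, fun i j hij => ?_⟩
  · filter_upwards [condInner_koopman hn hinv g (u i) (u i), ae_smul (hu.condInner_self i) g]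
      with x h1 h2
    rw [h1, h2]
    rfl
  · filter_upwards [condInner_koopman hn hinv g (u i) (u j),
      ae_smul (hu.condInner_eq_zero i j hij) g] with x h1 h2
    rw [h1, h2]
    rfl

/-- Joint measurability of the action makes the orbit maps into the separable space `L²`
measurable: the distance to a given vector is a parametrised integral. -/
lemma stronglyMeasurable_koopman [SecondCountableTopology (Lp ℝ 2 μ)] (f : Lp ℝ 2 μ) :
    StronglyMeasurable fun g : G => koopman μ g f := by
  borelize ↥(Lp ℝ 2 μ)
  have hdist : ∀ v : Lp ℝ 2 μ, Measurable fun g : G => dist (koopman μ g f) v := by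
    intro v
    have h1 : ∀ g : G, dist (koopman μ g f) v = Real.sqrt (∫ x, (f (g • x) - v x) ^ 2 ∂μ) := by
      intro g
      rw [dist_eq_norm, ← Real.sqrt_sq (norm_nonneg (koopman μ g f - v)), norm_sq_eq_integral]
      congr 1
      refine integral_congr_ae ?_
      filter_upwards [Lp.coeFn_sub (koopman μ g f) v, koopman_ae g f] with x h1 h2
      rw [h1, Pi.sub_apply, h2]
    simp only [h1]
    have h2 : StronglyMeasurable fun p : G × X => (f (p.1 • p.2) - v p.2) ^ 2 :=
      (((Lp.stronglyMeasurable f).comp_measurable measurable_smul).sub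
        ((Lp.stronglyMeasurable v).comp_measurable measurable_snd)).pow 2
    exact (h2.integral_prod_right' (ν := μ)).measurable.sqrt
  refine Measurable.stronglyMeasurable (measurable_of_isOpen fun U hU => ?_)
  obtain ⟨e, he⟩ := TopologicalSpace.exists_dense_seq (Lp ℝ 2 μ)
  have hUe : U =
      ⋃ p ∈ {p : ℕ × ℚ | Metric.ball (e p.1) p.2 ⊆ U}, Metric.ball (e p.1) (p.2 : ℝ) := by
    refine Set.Subset.antisymm (fun z hz => ?_) (Set.iUnion₂_subset fun p hp => hp)
    obtain ⟨r, hr, hrU⟩ := Metric.isOpen_iff.1 hU z hz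
    obtain ⟨q, hq0, hqr⟩ := exists_rat_btwn (half_pos hr)
    obtain ⟨k, hk⟩ := he.exists_dist_lt z hq0
    refine Set.mem_iUnion₂.2 ⟨(k, q), fun y hy => hrU ?_, hk⟩
    have h1 : dist y (e k) < q := hy
    rw [Metric.mem_ball]
    linarith [dist_triangle_right y z (e k)]
  rw [hUe, Set.preimage_iUnion₂]
  exact MeasurableSet.biUnion (Set.to_countable _) fun p _ =>
    measurableSet_lt (hdist (e p.1)) measurable_const

end Koopman

/-! ### Averages along a Følner sequence -/

section Averages

open scoped Pointwise

variable {G : Type*} [MeasurableSpace G] {m : Measure G} {Φ : ℕ → Set G}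

lemma setAverage_mono_of_nonneg {s : Set G} {p q : G → ℝ} (hq : ∀ g, 0 ≤ q g) (hqp : ∀ g, q g ≤ p g)
    (hp : IntegrableOn p s m) : ⨍ g in s, q g ∂m ≤ ⨍ g in s, p g ∂m := by
  rw [setAverage_eq, setAverage_eq, smul_eq_mul, smul_eq_mul]
  refine mul_le_mul_of_nonneg_left ?_ (inv_nonneg.2 measureReal_nonneg)
  exact integral_mono_of_nonneg (Eventually.of_forall hq) hp (Eventually.of_forall hqp)

lemma setAverage_nonneg {s : Set G} {q : G → ℝ} (hq : ∀ g, 0 ≤ q g) : 0 ≤ ⨍ g in s, q g ∂m := by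
  rw [setAverage_eq, smul_eq_mul]
  exact mul_nonneg (inv_nonneg.2 measureReal_nonneg) (integral_nonneg hq)

lemma setAverage_add {s : Set G} {p q : G → ℝ} (hp : IntegrableOn p s m) (hq : IntegrableOn q s m) :
    ⨍ g in s, (p g + q g) ∂m = ⨍ g in s, p g ∂m + ⨍ g in s, q g ∂m := by
  rw [setAverage_eq, setAverage_eq, setAverage_eq, integral_add hp hq, smul_add]

lemma setAverage_const_mul {s : Set G} (c : ℝ) (q : G → ℝ) :
    ⨍ g in s, c * q g ∂m = c * ⨍ g in s, q g ∂m := by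
  rw [setAverage_eq, setAverage_eq, integral_const_mul, smul_eq_mul, smul_eq_mul]
  ring

/-- A nonnegative function whose averages tend to zero if it is dominated, up to an arbitrarily
small error, by functions whose averages tend to zero. -/
lemma tendsto_setAverage_of_le_add (h0 : ∀ N, m (Φ N) ≠ 0) (htop : ∀ N, m (Φ N) ≠ ∞) {q : G → ℝ}
    (hq : ∀ g, 0 ≤ q g)
    (h : ∀ ε > 0, ∃ p : G → ℝ, (∀ N, IntegrableOn p (Φ N) m) ∧
      Tendsto (fun N => ⨍ g in Φ N, p g ∂m) atTop (𝓝 0) ∧ ∀ g, q g ≤ p g + ε) :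
    Tendsto (fun N => ⨍ g in Φ N, q g ∂m) atTop (𝓝 0) := by
  refine tendsto_order.2 ⟨fun a ha => Eventually.of_forall fun N =>
    ha.trans_le (setAverage_nonneg hq), fun b hb => ?_⟩
  obtain ⟨p, hpi, hp0, hqp⟩ := h (b / 2) (half_pos hb)
  filter_upwards [(tendsto_order.1 hp0).2 (b / 2) (half_pos hb)] with N hN
  have hc : IntegrableOn (fun _ : G => b / 2) (Φ N) m := integrableOn_const (htop N)
  calc ⨍ g in Φ N, q g ∂m ≤ ⨍ g in Φ N, (p g + b / 2) ∂m :=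
        setAverage_mono_of_nonneg hq hqp ((hpi N).add hc)
    _ = ⨍ g in Φ N, p g ∂m + b / 2 := by
        rw [setAverage_add (hpi N) hc, setAverage_const (h0 N) (htop N)]
    _ < b := by linarith

/-- Averages of a bounded function along a left Følner sequence are asymptotically invariant under
left translation. -/
lemma tendsto_setAverage_mul_left_sub [Group G] [MeasurableMul G] [m.IsMulLeftInvariant]
    (hΦ : IsFoelner G m atTop Φ) (hmeas : ∀ N, MeasurableSet (Φ N)) (htop : ∀ N, m (Φ N) ≠ ∞)
    {q : G → ℝ} (hqm : StronglyMeasurable q) {K : ℝ} (hK : ∀ g, |q g| ≤ K) (h : G) :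
    Tendsto (fun N => ⨍ g in Φ N, q (h * g) ∂m - ⨍ g in Φ N, q g ∂m) atTop (𝓝 0) := by
  have hlim :
      Tendsto (fun N => K * (m (symmDiff (h • Φ N) (Φ N)) / m (Φ N)).toReal) atTop (𝓝 0) := by
    have h1 := (ENNReal.tendsto_toReal ENNReal.zero_ne_top).comp (hΦ.tendsto_meas_smul_symmDiff h)
    simpa using h1.const_mul K
  refine squeeze_zero_norm (fun N => ?_) hlim
  have hhm : MeasurableSet (h • Φ N) := (hmeas N).const_smul h
  have hhtop : m (h • Φ N) ≠ ∞ := by rw [measure_smul]; exact htop N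
  have hint : ∀ s : Set G, MeasurableSet s → m s ≠ ∞ → IntegrableOn q s m := fun s _ hs' =>
    Measure.integrableOn_of_bounded (M := K) hs' hqm.aestronglyMeasurable
      (Eventually.of_forall fun g => hK g)
  have h1 : ∫ g in Φ N, q (h * g) ∂m = ∫ g in h • Φ N, q g ∂m := by
    rw [← integral_indicator (hmeas N), ← integral_indicator hhm,
      ← integral_mul_left_eq_self ((h • Φ N).indicator q) h]
    refine integral_congr_ae (Eventually.of_forall fun g => ?_)
    by_cases hg : g ∈ Φ N
    · have : h * g ∈ h • Φ N := Set.smul_mem_smul_set hg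
      simp [hg, this]
    · have : h * g ∉ h • Φ N := fun hh => hg (Set.smul_mem_smul_set_iff.1 hh)
      simp [hg, this]
  have hS : MeasurableSet (symmDiff (h • Φ N) (Φ N)) := hhm.symmDiff (hmeas N)
  have hStop : m (symmDiff (h • Φ N) (Φ N)) ≠ ∞ :=
    ne_top_of_le_ne_top (ENNReal.add_ne_top.2 ⟨hhtop, htop N⟩)
      ((measure_mono Set.symmDiff_subset_union).trans (measure_union_le _ _))
  have h2 : |∫ g in h • Φ N, q g ∂m - ∫ g in Φ N, q g ∂m| ≤
      K * m.real (symmDiff (h • Φ N) (Φ N)) := by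
    rw [← integral_indicator hhm, ← integral_indicator (hmeas N),
      ← integral_sub ((hint _ hhm hhtop).integrable_indicator hhm)
        ((hint _ (hmeas N) (htop N)).integrable_indicator (hmeas N))]
    have h3 : ∫ g, (symmDiff (h • Φ N) (Φ N)).indicator (fun _ => K) g ∂m =
        K * m.real (symmDiff (h • Φ N) (Φ N)) := by
      rw [integral_indicator_const _ hS, smul_eq_mul, mul_comm]
    rw [← h3, ← Real.norm_eq_abs]
    refine norm_integral_le_of_norm_le ((integrable_indicator_iff hS).2 (integrableOn_const hStop))
      (Eventually.of_forall fun g => ?_)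
    have := hK g
    by_cases h4 : g ∈ h • Φ N <;> by_cases h5 : g ∈ Φ N <;>
      simp [Set.indicator, Set.mem_symmDiff, h4, h5, this]
  rw [setAverage_eq, setAverage_eq, h1, ← smul_sub, norm_smul, Real.norm_eq_abs, Real.norm_eq_abs,
    abs_inv, abs_of_nonneg measureReal_nonneg, ENNReal.toReal_div]
  calc (m.real (Φ N))⁻¹ * |∫ g in h • Φ N, q g ∂m - ∫ g in Φ N, q g ∂m|
      ≤ (m.real (Φ N))⁻¹ * (K * m.real (symmDiff (h • Φ N) (Φ N))) := by gcongr
    _ = K * (m.real (symmDiff (h • Φ N) (Φ N)) / m.real (Φ N)) := by ring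

end Averages

/-! ### Decay of conditional correlations with vectors orthogonal to the eigenfunctions -/

section Decay

variable {G : Type*} [Group G] [MeasurableSpace G] {X : Type*} {n : MeasurableSpace X}
  [mX : MeasurableSpace X] [MulAction G X] [MeasurableSMul₂ G X] {μ : Measure X}
  [SMulInvariantMeasure G X μ] [IsProbabilityMeasure μ]

variable (n) in
/-- The size of the conditional correlation of `φ` with `f` moved by `g`. -/
def corr (φ f : Lp ℝ 2 μ) (g : G) : ℝ :=
  ∫ x, condInner n φ (koopman μ g f) x ^ 2 ∂μ

lemma corr_nonneg (φ f : Lp ℝ 2 μ) (g : G) : 0 ≤ corr n φ f g :=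
  integral_nonneg fun _ => sq_nonneg _

lemma corr_eq_norm_sq {φ : Lp ℝ 2 μ} {D : Lp ℝ 2 μ →L[ℝ] Lp ℝ 2 μ}
    (hD : ∀ ψ, D ψ =ᵐ[μ] condInner n φ ψ) (f : Lp ℝ 2 μ) (g : G) :
    corr n φ f g = ‖D (koopman μ g f)‖ ^ 2 := by
  rw [norm_sq_eq_integral]
  refine integral_congr_ae ?_
  filter_upwards [hD (koopman μ g f)] with x hx
  rw [hx]

variable [SecondCountableTopology (Lp ℝ 2 μ)] {m : Measure G} {Φ : ℕ → Set G}

lemma stronglyMeasurable_inner_koopman (D : Lp ℝ 2 μ →L[ℝ] Lp ℝ 2 μ) (φ ψ : Lp ℝ 2 μ) :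
    StronglyMeasurable fun g : G => (inner ℝ (D (koopman μ g φ)) (D (koopman μ g ψ)) : ℝ) :=
  (D.continuous.comp_stronglyMeasurable (stronglyMeasurable_koopman φ)).inner
    (D.continuous.comp_stronglyMeasurable (stronglyMeasurable_koopman ψ))

lemma abs_inner_koopman_le {D : Lp ℝ 2 μ →L[ℝ] Lp ℝ 2 μ} {C : ℝ} (hC : 0 ≤ C)
    (hD : ∀ φ, ‖D φ‖ ≤ C * ‖φ‖) (φ ψ : Lp ℝ 2 μ) (g : G) :
    |(inner ℝ (D (koopman μ g φ)) (D (koopman μ g ψ)) : ℝ)| ≤ C ^ 2 * ‖φ‖ * ‖ψ‖ := by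
  refine (abs_real_inner_le_norm _ _).trans ?_
  have h1 := hD (koopman μ g φ)
  have h2 := hD (koopman μ g ψ)
  rw [norm_koopman] at h1 h2
  calc _ ≤ (C * ‖φ‖) * (C * ‖ψ‖) := mul_le_mul h1 h2 (norm_nonneg _) (by positivity)
    _ = C ^ 2 * ‖φ‖ * ‖ψ‖ := by ring

lemma integrableOn_inner_koopman {D : Lp ℝ 2 μ →L[ℝ] Lp ℝ 2 μ} {C : ℝ} (hC : 0 ≤ C)
    (hD : ∀ φ, ‖D φ‖ ≤ C * ‖φ‖) (φ ψ : Lp ℝ 2 μ) {s : Set G} (hs : m s ≠ ∞) :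
    IntegrableOn (fun g : G => (inner ℝ (D (koopman μ g φ)) (D (koopman μ g ψ)) : ℝ)) s m :=
  Measure.integrableOn_of_bounded (M := C ^ 2 * ‖φ‖ * ‖ψ‖) hs
    (stronglyMeasurable_inner_koopman D φ ψ).aestronglyMeasurable
    (Eventually.of_forall fun g => abs_inner_koopman_le hC hD φ ψ g)

lemma integrableOn_corr (hn : n ≤ mX) {C : ℝ} (hC : 0 ≤ C) {φ : Lp ℝ 2 μ}
    (hφ : IsCondBounded n C φ) (f : Lp ℝ 2 μ) {s : Set G} (hs : m s ≠ ∞) :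
    IntegrableOn (fun g : G => corr n φ f g) s m := by
  obtain ⟨D, hD, hDC⟩ := exists_condInnerL hn hC hφ
  simp only [corr_eq_norm_sq hD, ← real_inner_self_eq_norm_sq]
  exact integrableOn_inner_koopman hC hDC f f hs

/-- The averaged correlation forms
`(φ, ψ) ↦ ⨍ g in s, ∫ 𝔼(w · T^g φ | n) 𝔼(w · T^g ψ | n)`, in terms of the operator
`D = 𝔼(w · | n)`. -/
def averageForm (m : Measure G) {D : Lp ℝ 2 μ →L[ℝ] Lp ℝ 2 μ} {C : ℝ} (hC : 0 ≤ C)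
    (hD : ∀ φ, ‖D φ‖ ≤ C * ‖φ‖) {s : Set G} (hs : m s ≠ ∞) :
    Lp ℝ 2 μ →ₗ[ℝ] Lp ℝ 2 μ →ₗ[ℝ] ℝ :=
  LinearMap.mk₂ ℝ
    (fun φ ψ => ⨍ g in s, (inner ℝ (D (koopman μ g φ)) (D (koopman μ g ψ)) : ℝ) ∂m)
    (fun φ φ' ψ => by
      rw [← setAverage_add (integrableOn_inner_koopman hC hD φ ψ hs)
        (integrableOn_inner_koopman hC hD φ' ψ hs)]
      simp only [← koopmanLI_apply, map_add, inner_add_left])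
    (fun c φ ψ => by
      rw [smul_eq_mul, ← setAverage_const_mul]
      simp only [← koopmanLI_apply, map_smul, real_inner_smul_left])
    (fun φ ψ ψ' => by
      rw [← setAverage_add (integrableOn_inner_koopman hC hD φ ψ hs)
        (integrableOn_inner_koopman hC hD φ ψ' hs)]
      simp only [← koopmanLI_apply, map_add, inner_add_right])
    (fun c φ ψ => by
      rw [smul_eq_mul, ← setAverage_const_mul]
      simp only [← koopmanLI_apply, map_smul, real_inner_smul_right])

lemma averageForm_apply {D : Lp ℝ 2 μ →L[ℝ] Lp ℝ 2 μ} {C : ℝ} (hC : 0 ≤ C)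
    (hD : ∀ φ, ‖D φ‖ ≤ C * ‖φ‖) {s : Set G} (hs : m s ≠ ∞) (φ ψ : Lp ℝ 2 μ) :
    averageForm m hC hD hs φ ψ =
      ⨍ g in s, (inner ℝ (D (koopman μ g φ)) (D (koopman μ g ψ)) : ℝ) ∂m := rfl

lemma setAverage_le_of_le {s : Set G} (h0 : m s ≠ 0) (hs : m s ≠ ∞) {q : G → ℝ} {K : ℝ}
    (hq : IntegrableOn q s m) (hK : ∀ g, q g ≤ K) : ⨍ g in s, q g ∂m ≤ K := by
  rw [← setAverage_const (μ := m) h0 hs K, setAverage_eq, setAverage_eq, smul_eq_mul, smul_eq_mul]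
  refine mul_le_mul_of_nonneg_left ?_ (inv_nonneg.2 measureReal_nonneg)
  exact integral_mono hq (integrableOn_const hs) hK

/-- Trace bound: on a frame over `B`, the correlations with a vector bounded by `C` sum to
at most `C² μ(B)`. -/
lemma sum_norm_sq_koopman_frame_le (hn : n ≤ mX)
    (hinv : ∀ g : G, @Measurable X X n n fun x => g • x) {C : ℝ} {w : Lp ℝ 2 μ}
    (hw : IsCondBounded n C w) {D : Lp ℝ 2 μ →L[ℝ] Lp ℝ 2 μ}
    (hD : ∀ φ, D φ =ᵐ[μ] condInner n w φ) {ι : Type*} [Fintype ι] {u : ι → Lp ℝ 2 μ} {B : Set X}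
    (hu : IsFrame n u fun _ => B) (hB : MeasurableSet[n] B) (g : G) :
    ∑ i, ‖D (koopman μ g (u i))‖ ^ 2 ≤ C ^ 2 * μ.real B := by
  have hug := hu.koopman hn hinv g
  have hgB : MeasurableSet ((fun x : X => g • x) ⁻¹' B) := hn _ (hinv g hB)
  have h1 : C ^ 2 * μ.real B =
      ∫ x, ((fun x : X => g • x) ⁻¹' B).indicator (fun _ => C ^ 2) x ∂μ := by
    rw [integral_indicator_const _ hgB, smul_eq_mul, mul_comm, measureReal_def, measureReal_def,
      (measurePreserving_smul g μ).measure_preimage (hn _ hB).nullMeasurableSet]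
  have h2 : ∀ i, Integrable (fun x => D (koopman μ g (u i)) x ^ 2) μ := fun i =>
    (Lp.memLp _).integrable_sq
  simp only [norm_sq_eq_integral]
  rw [← integral_finsetSum _ fun i _ => h2 i, h1]
  refine integral_mono_ae (integrable_finsetSum _ fun i _ => h2 i)
    ((integrable_indicator_iff hgB).2 (integrableOn_const (measure_ne_top _ _))) ?_
  filter_upwards [ae_all_iff.2 fun i => hD (koopman μ g (u i)), hug.sum_sq_le hn w, hw,
    ae_all_iff.2 fun i => condInner_sq_le (n := n) w (koopman μ g (u i)),
    ae_all_iff.2 hug.condInner_self] with x e1 e2 e3 e4 e5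
  simp only [e1]
  by_cases hx : x ∈ (fun x : X => g • x) ⁻¹' B
  · rw [Set.indicator_of_mem hx]
    simp only [condInner_comm w]
    exact e2.trans e3
  · rw [Set.indicator_of_notMem hx]
    refine Finset.sum_nonpos fun i _ => ?_
    have h3 := e4 i
    rwa [e5 i, Set.indicator_of_notMem hx, mul_zero] at h3

/-- Let `E` be an invariant closed module that contains all invariant closed modules of finite rank.
If `w` is conditionally bounded and orthogonal to `E`, then the conditional correlations of `w` with
every orbit vanish on average.

A limit `A` of the averaged correlation forms along an ultrafilter is a positive operator that
commutes with `n`-multiplications and, by the Følner property, with the action, and it vanishes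
on `E`. On the range of an operator in the bicommutant of `A` on which `A` is bounded below, the
trace bound limits the number of conditionally orthonormal vectors, so that this range is in `E`.
Hence `A = 0`. -/
lemma tendsto_average_corr_of_mem_orthogonal [MeasurableMul G] [m.IsMulLeftInvariant]
    (hΦ : IsFoelner G m atTop Φ) (hmeas : ∀ N, MeasurableSet (Φ N)) (h0 : ∀ N, m (Φ N) ≠ 0)
    (htop : ∀ N, m (Φ N) ≠ ∞) (hn : n ≤ mX)
    (hinv : ∀ g : G, @Measurable X X n n fun x => g • x) {E : Submodule ℝ (Lp ℝ 2 μ)}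
    (hE : IsClosedModule n E) (hEinv : ∀ (g : G), ∀ e ∈ E, koopman μ g e ∈ E)
    (hEmax : ∀ (d : ℕ) (M : Submodule ℝ (Lp ℝ 2 μ)), IsClosedModule n M →
      (∀ (g : G), ∀ e ∈ M, koopman μ g e ∈ M) → RankLE n d M → M ≤ E)
    {C : ℝ} (hC : 0 ≤ C) {w : Lp ℝ 2 μ} (hw : IsCondBounded n C w) (hwE : w ∈ Eᗮ)
    (φ : Lp ℝ 2 μ) :
    Tendsto (fun N => ⨍ g in Φ N, corr n w φ g ∂m) atTop (𝓝 0) := by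
  obtain ⟨D, hD, hDC⟩ := exists_condInnerL hn hC hw
  rw [tendsto_iff_ultrafilter]
  intro U hU
  let F : ℕ → Lp ℝ 2 μ →ₗ[ℝ] Lp ℝ 2 μ →ₗ[ℝ] ℝ := fun N => averageForm m hC hDC (htop N)
  have hFbd : ∀ N φ ψ, |F N φ ψ| ≤ C ^ 2 * ‖φ‖ * ‖ψ‖ := by
    intro N φ ψ
    have hint := integrableOn_inner_koopman (m := m) hC hDC φ ψ (htop N)
    have hle := fun g : G => abs_le.1 (abs_inner_koopman_le hC hDC φ ψ g)
    refine abs_le.2 ⟨?_, setAverage_le_of_le (h0 N) (htop N) hint fun g => (hle g).2⟩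
    have h1 := setAverage_le_of_le (h0 N) (htop N) hint.neg fun g => neg_le.2 (hle g).1
    have h2 : ⨍ g in Φ N, -(inner ℝ (D (koopman μ g φ)) (D (koopman μ g ψ)) : ℝ) ∂m =
        -⨍ g in Φ N, (inner ℝ (D (koopman μ g φ)) (D (koopman μ g ψ)) : ℝ) ∂m := by
      simp only [setAverage_eq, integral_neg, smul_neg]
    have h3 : ⨍ g in Φ N, -(inner ℝ (D (koopman μ g φ)) (D (koopman μ g ψ)) : ℝ) ∂m ≤
        C ^ 2 * ‖φ‖ * ‖ψ‖ := h1
    rw [h2] at h3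
    exact neg_le.1 h3
  obtain ⟨A, hA⟩ := exists_operator_tendsto_ultrafilter U F (C ^ 2) hFbd
  have hsymm : ∀ φ ψ, inner ℝ (A φ) ψ = inner ℝ φ (A ψ) := by
    intro φ ψ
    rw [real_inner_comm (A ψ) φ]
    refine tendsto_nhds_unique (hA φ ψ) ((hA ψ φ).congr fun N => ?_)
    simp only [F, averageForm_apply]
    congr 1
    funext g
    exact real_inner_comm _ _
  have hpos : ∀ φ, 0 ≤ inner ℝ (A φ) φ := fun φ =>
    ge_of_tendsto (hA φ φ) (Eventually.of_forall fun N => by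
      simp only [F, averageForm_apply]
      exact setAverage_nonneg fun g => real_inner_self_nonneg)
  have hAE : ∀ e ∈ E, A e = 0 := by
    intro e he
    refine ext_inner_right ℝ fun ψ => ?_
    rw [inner_zero_left]
    refine tendsto_nhds_unique (hA e ψ) (tendsto_const_nhds.congr fun N => ?_)
    have h1 : ∀ g : G, D (koopman μ g e) = 0 := fun g => by
      rw [Lp.eq_zero_iff_ae_eq_zero]
      exact (hD _).trans (hE.condInner_eq_zero hn hwE (hEinv g e he))
    simp only [F, averageForm_apply, h1, inner_zero_left]
    rw [setAverage_const (h0 N) (htop N)]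
  have hAT : ∀ (h : G) φ, A (koopman μ h φ) = koopman μ h (A φ) := by
    intro h φ
    refine ext_inner_right ℝ fun ψ => ?_
    -- Write `ψ` as the image of `ψ'`.
    set ψ' := koopman μ h⁻¹ ψ with hψ'
    have hψ : koopman μ h ψ' = ψ := by rw [hψ', koopman_koopman, inv_mul_cancel, koopman_one]
    rw [← hψ, inner_koopman]
    have h1 := tendsto_setAverage_mul_left_sub hΦ hmeas htop
      (stronglyMeasurable_inner_koopman D φ ψ') (abs_inner_koopman_le hC hDC φ ψ') h
    have h2 := (h1.mono_left hU).add (hA φ ψ')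
    rw [zero_add] at h2
    refine tendsto_nhds_unique (hA (koopman μ h φ) (koopman μ h ψ')) (h2.congr fun N => ?_)
    simp only [F, averageForm_apply, koopman_koopman]
    ring
  have hAL : ∀ (a : X → ℝ) (L : Lp ℝ 2 μ →L[ℝ] Lp ℝ 2 μ), StronglyMeasurable[n] a →
      (∀ φ, L φ =ᵐ[μ] fun x => a x * φ x) → ∀ φ, A (L φ) = L (A φ) := by
    intro a L ha hL φ
    refine ext_inner_right ℝ fun ψ => ?_
    have h1 : inner ℝ (L (A φ)) ψ = inner ℝ (A φ) (L ψ) := by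
      rw [inner_eq_integral_mul, inner_eq_integral_mul]
      refine integral_congr_ae ?_
      filter_upwards [hL (A φ), hL ψ] with x h1 h2
      rw [h1, h2]; ring
    rw [h1]
    refine tendsto_nhds_unique (hA (L φ) ψ) ((hA φ (L ψ)).congr fun N => ?_)
    simp only [F, averageForm_apply]
    congr 1
    funext g
    rw [inner_eq_integral_mul, inner_eq_integral_mul]
    refine integral_congr_ae ?_
    have h2 : ∀ φ, D (koopman μ g (L φ)) =ᵐ[μ] fun x => a (g • x) * D (koopman μ g φ) x := by
      intro φ
      have h3 : koopman μ g (L φ) =ᵐ[μ] fun x => a (g • x) * koopman μ g φ x := by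
        filter_upwards [koopman_ae g (L φ), koopman_ae g φ, ae_smul (hL φ) g] with x e1 e2 e3
        rw [e1, e2, e3]
      filter_upwards [hD (koopman μ g (L φ)), hD (koopman μ g φ),
        condInner_mul_right (ha.comp_measurable (hinv g)) h3 w] with x e1 e2 e3
      rw [e1, e2, e3]
      rfl
    filter_upwards [h2 φ, h2 ψ] with x e1 e2
    rw [e1, e2]; ring
  have hrange : ∀ (ε : ℝ) (θ : Lp ℝ 2 μ →L[ℝ] Lp ℝ 2 μ), 0 < ε →
      (∀ T : Lp ℝ 2 μ →L[ℝ] Lp ℝ 2 μ, T * A = A * T → T * θ = θ * T) →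
      (∀ x, ε * ‖θ x‖ ^ 2 ≤ inner ℝ (A (θ x)) (θ x)) → ∀ x, θ x ∈ E := by
    intro ε θ hε hθ hθA
    set M : Submodule ℝ (Lp ℝ 2 μ) := (LinearMap.range θ.toLinearMap).topologicalClosure with hM
    have hMcl : IsClosed (M : Set (Lp ℝ 2 μ)) := Submodule.isClosed_topologicalClosure _
    have hθM : ∀ x, θ x ∈ M := fun x => Submodule.le_topologicalClosure _ ⟨x, rfl⟩
    have hclosure : ∀ P : Lp ℝ 2 μ → Prop, IsClosed {h | P h} → (∀ x, P (θ x)) → ∀ h ∈ M, P h := by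
      intro P hP hPθ h hh
      refine hP.closure_subset_iff.2 ?_ hh
      rintro _ ⟨x, rfl⟩
      exact hPθ x
    have hcomm : ∀ T : Lp ℝ 2 μ →L[ℝ] Lp ℝ 2 μ, (∀ φ, A (T φ) = T (A φ)) →
        ∀ h ∈ M, T h ∈ M := by
      intro T hT
      refine hclosure (fun h => T h ∈ M) (hMcl.preimage T.continuous) fun x => ?_
      have h1 : T (θ x) = θ (T x) :=
        DFunLike.congr_fun (hθ T (ContinuousLinearMap.ext fun φ => (hT φ).symm)) x
      rw [h1]
      exact hθM _
    have hMmod : IsClosedModule n M := by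
      refine ⟨hMcl, fun a K ha hK h hh h' hh' => ?_⟩
      obtain ⟨L, hL⟩ := exists_mulL (μ := μ) hn ha hK
      rw [Lp.ext (hh'.trans (hL h).symm)]
      exact hcomm L (hAL a L ha hL) h hh
    have hMinv : ∀ g : G, ∀ e ∈ M, koopman μ g e ∈ M := fun g =>
      hcomm (koopmanLI μ g).toContinuousLinearMap (hAT g)
    have hMlow : ∀ h ∈ M, ε * ‖h‖ ^ 2 ≤ inner ℝ (A h) h :=
      hclosure _ (isClosed_le (by fun_prop) (A.continuous.inner continuous_id)) hθA
    -- A conditionally orthonormal family of `d + 1 > C² / ε` vectors over a set of positive measure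
    -- would violate the trace bound.
    obtain ⟨d, hd⟩ := exists_nat_gt (C ^ 2 / ε)
    have hd' : C ^ 2 < ε * (d + 1) := by
      rw [div_lt_iff₀ hε] at hd
      nlinarith
    refine fun x => hEmax d M hMmod hMinv (fun B u huM hu => ?_) (hθM x)
    have hB : MeasurableSet[n] B := hu.measurableSet 0
    have hub : ∀ i, ‖u i‖ ^ 2 = μ.real B := by
      intro i
      rw [← real_inner_self_eq_norm_sq, ← integral_condInner hn,
        integral_congr_ae (hu.condInner_self i), integral_indicator_one (hn _ hB)]
    have h1 : ε * (d + 1) * μ.real B ≤ ∑ i, inner ℝ (A (u i)) (u i) := by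
      calc ε * (d + 1) * μ.real B = ∑ i, ε * ‖u i‖ ^ 2 := by
            simp only [hub, Finset.sum_const, Finset.card_univ, Fintype.card_fin, nsmul_eq_mul]
            push_cast
            ring
        _ ≤ _ := Finset.sum_le_sum fun i _ => hMlow (u i) (huM i)
    have h2 : ∑ i, inner ℝ (A (u i)) (u i) ≤ C ^ 2 * μ.real B := by
      refine le_of_tendsto (tendsto_finsetSum _ fun i _ => hA (u i) (u i))
        (Eventually.of_forall fun N => ?_)
      have hint : ∀ i, IntegrableOn (fun g : G => ‖D (koopman μ g (u i))‖ ^ 2) (Φ N) m := by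
        intro i
        simpa only [real_inner_self_eq_norm_sq] using
          integrableOn_inner_koopman (m := m) hC hDC (u i) (u i) (htop N)
      have h3 : ∑ i, F N (u i) (u i) = ⨍ g in Φ N, ∑ i, ‖D (koopman μ g (u i))‖ ^ 2 ∂m := by
        simp only [F, averageForm_apply, real_inner_self_eq_norm_sq, setAverage_eq]
        rw [integral_finsetSum _ fun i _ => hint i, Finset.smul_sum]
      rw [h3]
      exact setAverage_le_of_le (h0 N) (htop N) (integrable_finsetSum _ fun i _ => hint i)
        fun g => sum_norm_sq_koopman_frame_le hn hinv hw hD hu hB g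
    have h3 : μ.real B = 0 := by
      have h4 : 0 ≤ μ.real B := measureReal_nonneg
      nlinarith
    exact (measureReal_eq_zero_iff (measure_ne_top _ _)).1 h3
  have : CompleteSpace E := hE.isClosed.completeSpace_coe
  have hfin := inner_self_eq_zero_of_range_le A hsymm hpos E hAE hrange φ
  have h1 := hA φ φ
  rw [hfin] at h1
  refine h1.congr fun N => ?_
  simp only [F, averageForm_apply, real_inner_self_eq_norm_sq, corr_eq_norm_sq hD]

end Decay

/-! ### Eigenfunctions and invariant closed modules of finite rank -/

section Eigenfunctions

variable {G : Type*} [Group G] [MeasurableSpace G]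
  {X : Type*} [mX : MeasurableSpace X] [MulAction G X] [MeasurableSMul₂ G X]
  {Y : Type*} [mY : MeasurableSpace Y] [MulAction G Y] [MeasurableSMul₂ G Y]
  {μ : Measure X} [SMulInvariantMeasure G X μ] {ν : Measure Y} [SMulInvariantMeasure G Y ν]
  {π : X → Y}

lemma IsFactorMap.comap_le (hπ : IsFactorMap G μ ν π) : mY.comap π ≤ mX :=
  hπ.measurePreserving.measurable.comap_le

lemma IsFactorMap.measurable_smul_comap (hπ : IsFactorMap G μ ν π) (g : G) :
    @Measurable X X (mY.comap π) (mY.comap π) fun x => g • x := by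
  rintro _ ⟨t, ht, rfl⟩
  refine ⟨(fun y => g • y) ⁻¹' t, measurable_const_smul g ht, ?_⟩
  ext x
  simp [hπ.map_smul]

lemma baseMul_ae (hπ : IsFactorMap G μ ν π) (α : Lp ℝ ∞ ν) (f : Lp ℝ 2 μ) :
    baseMul hπ α f =ᵐ[μ] fun x => α (π x) * f x := by
  filter_upwards [Lp.coeFn_lpSMul (r := 2)
    (Lp.compMeasurePreserving π hπ.measurePreserving α : Lp ℝ ∞ μ) f,
    Lp.coeFn_compMeasurePreserving α hπ.measurePreserving] with x h1 h2
  rw [baseMul, h1, Pi.smul_apply', h2]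
  rfl

lemma ae_comp (hπ : IsFactorMap G μ ν π) {p : Y → Prop} (h : ∀ᵐ y ∂ν, p y) : ∀ᵐ x ∂μ, p (π x) :=
  hπ.measurePreserving.quasiMeasurePreserving.ae h

lemma baseMul_add (hπ : IsFactorMap G μ ν π) (α β : Lp ℝ ∞ ν) (f : Lp ℝ 2 μ) :
    baseMul hπ (α + β) f = baseMul hπ α f + baseMul hπ β f := by
  refine Lp.ext ?_
  filter_upwards [baseMul_ae hπ (α + β) f, baseMul_ae hπ α f, baseMul_ae hπ β f,
    Lp.coeFn_add (baseMul hπ α f) (baseMul hπ β f), ae_comp hπ (Lp.coeFn_add α β)]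
    with x h1 h2 h3 h4 h5
  rw [h1, h4, Pi.add_apply, h2, h3, h5, Pi.add_apply, add_mul]

lemma baseMul_smul (hπ : IsFactorMap G μ ν π) (c : ℝ) (α : Lp ℝ ∞ ν) (f : Lp ℝ 2 μ) :
    baseMul hπ (c • α) f = c • baseMul hπ α f := by
  refine Lp.ext ?_
  filter_upwards [baseMul_ae hπ (c • α) f, baseMul_ae hπ α f,
    Lp.coeFn_smul c (baseMul hπ α f), ae_comp hπ (Lp.coeFn_smul c α)] with x h1 h2 h3 h4
  rw [h1, h3, Pi.smul_apply, h2, h4, Pi.smul_apply, smul_eq_mul, smul_eq_mul, mul_assoc]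

lemma baseMul_zero (hπ : IsFactorMap G μ ν π) (f : Lp ℝ 2 μ) : baseMul hπ 0 f = 0 := by
  simpa using baseMul_smul hπ 0 0 f

lemma baseMul_baseMul (hπ : IsFactorMap G μ ν π) (α β : Lp ℝ ∞ ν) (f : Lp ℝ 2 μ) :
    baseMul hπ α (baseMul hπ β f) = baseMul hπ (α • β : Lp ℝ ∞ ν) f := by
  refine Lp.ext ?_
  filter_upwards [baseMul_ae hπ α (baseMul hπ β f), baseMul_ae hπ β f,
    baseMul_ae hπ (α • β : Lp ℝ ∞ ν) f, ae_comp hπ (Lp.coeFn_lpSMul (r := ∞) α β)]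
    with x h1 h2 h3 h4
  rw [h1, h2, h3, h4, Pi.smul_apply', smul_eq_mul, mul_assoc]

lemma koopman_baseMul (hπ : IsFactorMap G μ ν π) (g : G) (α : Lp ℝ ∞ ν) (f : Lp ℝ 2 μ) :
    koopman μ g (baseMul hπ α f) =
      baseMul hπ (Lp.compMeasurePreserving (fun y : Y => g • y) (measurePreserving_smul g ν) α)
        (koopman μ g f) := by
  refine Lp.ext ?_
  filter_upwards [koopman_ae g (baseMul hπ α f), ae_smul (baseMul_ae hπ α f) g, koopman_ae g f,
    baseMul_ae hπ (Lp.compMeasurePreserving (fun y : Y => g • y) (measurePreserving_smul g ν) α)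
      (koopman μ g f),
    ae_comp hπ (Lp.coeFn_compMeasurePreserving α (measurePreserving_smul g ν))]
    with x h1 h2 h3 h4 h5
  rw [h1, h2, h4, h3, h5, Function.comp_apply, hπ.map_smul]

variable [IsProbabilityMeasure μ] [IsProbabilityMeasure ν]

lemma baseMul_one (hπ : IsFactorMap G μ ν π) : ∃ α : Lp ℝ ∞ ν, ∀ f, baseMul hπ α f = f := by
  have h : MemLp (fun _ : Y => (1 : ℝ)) ∞ ν := memLp_const 1
  refine ⟨h.toLp, fun f => Lp.ext ?_⟩
  filter_upwards [baseMul_ae hπ h.toLp f, ae_comp hπ h.coeFn_toLp] with x h1 h2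
  rw [h1, h2, one_mul]

/-- Bounded functions measurable for the σ-algebra of the factor are functions on the factor. -/
lemma exists_eq_baseMul (hπ : IsFactorMap G μ ν π) {a : X → ℝ}
    (ha : StronglyMeasurable[mY.comap π] a) {C : ℝ} (hC : ∀ x, |a x| ≤ C) :
    ∃ α : Lp ℝ ∞ ν, ∀ f : Lp ℝ 2 μ, baseMul hπ α f =ᵐ[μ] fun x => a x * f x := by
  obtain ⟨b, hb, rfl⟩ := ha.measurable.exists_eq_measurable_comp
  have hm : Measurable fun y => max (-C) (min C (b y)) :=
    measurable_const.max (measurable_const.min hb)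
  have h : MemLp (fun y => max (-C) (min C (b y))) ∞ ν := by
    refine memLp_top_of_bound hm.aestronglyMeasurable |C| (Eventually.of_forall fun y => ?_)
    refine abs_le.2 ⟨?_, ?_⟩
    · exact (neg_le_neg (le_abs_self C)).trans (le_max_left _ _)
    · exact max_le (neg_le_abs C) ((min_le_left _ _).trans (le_abs_self C))
  refine ⟨h.toLp, fun f => ?_⟩
  filter_upwards [baseMul_ae hπ h.toLp f, ae_comp hπ h.coeFn_toLp] with x h1 h2
  have h3 : -C ≤ b (π x) ∧ b (π x) ≤ C := abs_le.1 (hC x)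
  rw [h1, h2, min_eq_right h3.2, max_eq_right h3.1]
  rfl

lemma IsClosedModule.baseMul_mem (hπ : IsFactorMap G μ ν π) {M : Submodule ℝ (Lp ℝ 2 μ)}
    (hM : IsClosedModule (mY.comap π) M) (α : Lp ℝ ∞ ν) {h : Lp ℝ 2 μ} (hh : h ∈ M) :
    baseMul hπ α h ∈ M :=
  hM.mul_mem hπ.comap_le (a := fun x => α (π x))
    ((Lp.stronglyMeasurable α).comp_measurable (comap_measurable π)) hh (baseMul_ae hπ α h)

/-- A bounded operator that maps the set `s` into its closed span preserves this span. -/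
lemma map_mem_closure_span {E : Type*} [NormedAddCommGroup E] [NormedSpace ℝ E] {s : Set E}
    (L : E →L[ℝ] E) (hL : ∀ x ∈ s, L x ∈ (Submodule.span ℝ s).topologicalClosure) :
    ∀ x ∈ (Submodule.span ℝ s).topologicalClosure,
      L x ∈ (Submodule.span ℝ s).topologicalClosure := by
  have h : (Submodule.span ℝ s).topologicalClosure ≤
      (Submodule.span ℝ s).topologicalClosure.comap L.toLinearMap :=
    Submodule.topologicalClosure_minimal _ (Submodule.span_le.2 hL)
      ((Submodule.isClosed_topologicalClosure _).preimage L.continuous)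
  exact fun x hx => h hx

lemma isClosedModule_closure_span (hπ : IsFactorMap G μ ν π) {s : Set (Lp ℝ 2 μ)}
    (hs : ∀ (a : X → ℝ) (C : ℝ), StronglyMeasurable[mY.comap π] a → (∀ x, |a x| ≤ C) →
      ∀ h ∈ s, ∀ h' : Lp ℝ 2 μ, (h' =ᵐ[μ] fun x => a x * h x) →
        h' ∈ (Submodule.span ℝ s).topologicalClosure) :
    IsClosedModule (mY.comap π) (Submodule.span ℝ s).topologicalClosure := by
  refine ⟨Submodule.isClosed_topologicalClosure _, fun a C ha hC h hh h' hh' => ?_⟩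
  obtain ⟨L, hL⟩ := exists_mulL (μ := μ) hπ.comap_le ha hC
  rw [Lp.ext (hh'.trans (hL h).symm)]
  exact map_mem_closure_span L (fun x hx => hs a C ha hC x hx _ (hL x)) h hh

lemma isClosedModule_orbitModule (hπ : IsFactorMap G μ ν π) (f : Lp ℝ 2 μ) :
    IsClosedModule (mY.comap π) (orbitModule hπ f) := by
  refine isClosedModule_closure_span hπ fun a C ha hC h hh h' hh' => ?_
  obtain ⟨α, g, rfl⟩ := hh
  obtain ⟨β, hβ⟩ := exists_eq_baseMul hπ ha hC
  rw [Lp.ext (hh'.trans (hβ _).symm), baseMul_baseMul]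
  exact Submodule.le_topologicalClosure _ (Submodule.subset_span ⟨_, g, rfl⟩)

lemma koopman_mem_orbitModule (hπ : IsFactorMap G μ ν π) (f : Lp ℝ 2 μ) (h : G) :
    ∀ e ∈ orbitModule hπ f, koopman μ h e ∈ orbitModule hπ f := by
  refine map_mem_closure_span (koopmanLI μ h).toContinuousLinearMap ?_
  rintro _ ⟨α, g, rfl⟩
  refine Submodule.le_topologicalClosure _ (Submodule.subset_span
    ⟨Lp.compMeasurePreserving (fun y : Y => h • y) (measurePreserving_smul h ν) α, g * h, ?_⟩)
  change koopman μ h _ = _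
  rw [koopman_baseMul, koopman_koopman]

lemma self_mem_orbitModule (hπ : IsFactorMap G μ ν π) (f : Lp ℝ 2 μ) : f ∈ orbitModule hπ f := by
  obtain ⟨α, hα⟩ := baseMul_one hπ
  refine Submodule.le_topologicalClosure _ (Submodule.subset_span ⟨α, 1, ?_⟩)
  rw [hα, koopman_one]

/-- The module of the combinations `∑ αᵢ φᵢ` with coefficients `αᵢ ∈ L^∞(Y)`. -/
def baseSpan (hπ : IsFactorMap G μ ν π) {d : ℕ} (φ : Fin d → Lp ℝ 2 μ) :
    Submodule ℝ (Lp ℝ 2 μ) where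
  carrier := {h | ∃ α : Fin d → Lp ℝ ∞ ν, h = ∑ i, baseMul hπ (α i) (φ i)}
  zero_mem' := ⟨0, by simp [baseMul_zero]⟩
  add_mem' := by
    rintro _ _ ⟨α, rfl⟩ ⟨β, rfl⟩
    exact ⟨α + β, by simp [baseMul_add, Finset.sum_add_distrib]⟩
  smul_mem' := by
    rintro c _ ⟨α, rfl⟩
    exact ⟨c • α, by simp [baseMul_smul, Finset.smul_sum]⟩

lemma isClosedModule_closure_baseSpan (hπ : IsFactorMap G μ ν π) {d : ℕ} (φ : Fin d → Lp ℝ 2 μ) :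
    IsClosedModule (mY.comap π) (baseSpan hπ φ).topologicalClosure := by
  rw [← Submodule.span_eq (baseSpan hπ φ)]
  refine isClosedModule_closure_span hπ fun a C ha hC h hh h' hh' => ?_
  obtain ⟨α, rfl⟩ := hh
  obtain ⟨β, hβ⟩ := exists_eq_baseMul hπ ha hC
  obtain ⟨L, hL⟩ := exists_mulL (μ := μ) hπ.comap_le ha hC
  rw [Lp.ext (hh'.trans (hL _).symm), map_sum]
  refine Submodule.le_topologicalClosure _ (Submodule.subset_span ⟨fun i => β • α i, ?_⟩)
  refine Finset.sum_congr rfl fun i _ => ?_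
  rw [← baseMul_baseMul]
  exact Lp.ext ((hL _).trans (hβ _).symm)

lemma mem_baseSpan_closure (hπ : IsFactorMap G μ ν π) {d : ℕ} (φ : Fin d → Lp ℝ 2 μ) (i : Fin d) :
    φ i ∈ (baseSpan hπ φ).topologicalClosure := by
  obtain ⟨α, hα⟩ := baseMul_one hπ
  refine Submodule.le_topologicalClosure _
    ⟨Pi.single i α, ?_⟩
  rw [Finset.sum_eq_single i (fun j _ hj => by rw [Pi.single_eq_of_ne hj, baseMul_zero])
    (fun h => absurd (Finset.mem_univ i) h), Pi.single_eq_same, hα]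

variable [SecondCountableTopology (Lp ℝ 2 μ)]

/-- The eigenfunctions are the elements of the invariant closed modules of finite rank; the rank
condition in this form passes to submodules. -/
lemma isEigenfunction_iff (hπ : IsFactorMap G μ ν π) (f : Lp ℝ 2 μ) :
    IsEigenfunction hπ f ↔ ∃ (d : ℕ) (M : Submodule ℝ (Lp ℝ 2 μ)),
      IsClosedModule (mY.comap π) M ∧ (∀ g : G, ∀ e ∈ M, koopman μ g e ∈ M) ∧
        RankLE (mY.comap π) d M ∧ f ∈ M := by
  constructor
  · rintro ⟨d, φ, hφ⟩
    refine ⟨d, orbitModule hπ f, isClosedModule_orbitModule hπ f, koopman_mem_orbitModule hπ f,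
      rankLE_of_generatedBy hπ.comap_le (φ := φ) fun N hN hφN => ?_, self_mem_orbitModule hπ f⟩
    intro h hh
    rw [← SetLike.mem_coe, ← hφ] at hh
    refine hN.isClosed.closure_subset_iff.2 ?_ hh
    rintro _ ⟨α, rfl⟩
    exact Submodule.sum_mem _ fun i _ => hN.baseMul_mem hπ (α i) (hφN i)
  · rintro ⟨d, M, hM, hMinv, hd, hf⟩
    have hle : orbitModule hπ f ≤ M := by
      refine Submodule.topologicalClosure_minimal _ (Submodule.span_le.2 ?_) hM.isClosed
      rintro _ ⟨α, g, rfl⟩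
      exact hM.baseMul_mem hπ α (hMinv g f hf)
    have hO := isClosedModule_orbitModule hπ f
    obtain ⟨φ, hφ, hgen⟩ := hO.exists_generators hπ.comap_le (hd.mono hle)
    refine ⟨d, φ, Set.Subset.antisymm (hO.isClosed.closure_subset_iff.2 ?_) ?_⟩
    · rintro _ ⟨α, rfl⟩
      exact Submodule.sum_mem _ fun i _ => hO.baseMul_mem hπ (α i) (hφ i)
    · exact hgen _ (isClosedModule_closure_baseSpan hπ φ) (mem_baseSpan_closure hπ φ)

lemma isClosedModule_eig (hπ : IsFactorMap G μ ν π) : IsClosedModule (mY.comap π) (eig hπ) := by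
  refine isClosedModule_closure_span hπ fun a C ha hC h hh h' hh' => ?_
  obtain ⟨d, M, hM, hMinv, hd, hf⟩ := (isEigenfunction_iff hπ h).1 hh
  exact Submodule.le_topologicalClosure _ (Submodule.subset_span ((isEigenfunction_iff hπ h').2
    ⟨d, M, hM, hMinv, hd, hM.mul_mem_of_bounded a C ha hC h hf h' hh'⟩))

lemma koopman_mem_eig (hπ : IsFactorMap G μ ν π) (g : G) :
    ∀ e ∈ eig hπ, koopman μ g e ∈ eig hπ := by
  refine map_mem_closure_span (koopmanLI μ g).toContinuousLinearMap fun f hf => ?_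
  obtain ⟨d, M, hM, hMinv, hd, hf⟩ := (isEigenfunction_iff hπ f).1 hf
  exact Submodule.le_topologicalClosure _ (Submodule.subset_span
    ((isEigenfunction_iff hπ (koopman μ g f)).2 ⟨d, M, hM, hMinv, hd, hMinv g f hf⟩))

lemma le_eig (hπ : IsFactorMap G μ ν π) (d : ℕ) (M : Submodule ℝ (Lp ℝ 2 μ))
    (hM : IsClosedModule (mY.comap π) M) (hMinv : ∀ g : G, ∀ e ∈ M, koopman μ g e ∈ M)
    (hd : RankLE (mY.comap π) d M) : M ≤ eig hπ := fun f hf =>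
  Submodule.le_topologicalClosure _ (Submodule.subset_span
    ((isEigenfunction_iff hπ f).2 ⟨d, M, hM, hMinv, hd, hf⟩))

end Eigenfunctions

/-! ### Approximation by bounded and conditionally bounded vectors -/

section Approximation

variable {X : Type*} {n mX : MeasurableSpace X} {μ : Measure X} [IsProbabilityMeasure μ]

lemma exists_isCondBounded_of_bounded (hn : n ≤ mX) {φ : Lp ℝ 2 μ} {C : ℝ}
    (hφ : ∀ᵐ x ∂μ, |φ x| ≤ C) : ∃ K : ℝ, 0 ≤ K ∧ IsCondBounded n K φ := by
  refine ⟨|C|, abs_nonneg C, ?_⟩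
  have h1 := condExp_mono (m := n) (integrable_mul_Lp φ φ) (integrable_const (C ^ 2)) <| by
    filter_upwards [hφ] with x hx
    calc φ x * φ x = |φ x| ^ 2 := by rw [sq_abs, sq]
      _ ≤ C ^ 2 := pow_le_pow_left₀ (abs_nonneg _) hx 2
  rw [condExp_const hn] at h1
  filter_upwards [h1] with x hx
  rw [sq_abs]
  exact hx

/-- Bounded functions are dense in `L²`. -/
lemma exists_bounded_norm_sub_lt (φ : Lp ℝ 2 μ) {ε : ℝ} (hε : 0 < ε) :
    ∃ (ψ : Lp ℝ 2 μ) (C : ℝ), (∀ᵐ x ∂μ, |ψ x| ≤ C) ∧ ‖φ - ψ‖ < ε := by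
  have hm : ∀ k : ℕ, MemLp ({x | |φ x| ≤ k}.indicator φ) 2 μ := fun k =>
    (Lp.memLp φ).indicator (measurableSet_abs_le (Lp.stronglyMeasurable φ) k)
  have hlim := tendsto_truncation (a := φ) φ (fun k => (hm k).toLp) fun k => (hm k).coeFn_toLp
  obtain ⟨k, hk⟩ := ((Metric.tendsto_nhds.1 hlim) ε hε).exists
  refine ⟨(hm k).toLp, k, ?_, by rwa [dist_comm, dist_eq_norm] at hk⟩
  filter_upwards [(hm k).coeFn_toLp] with x hx
  rw [hx]
  by_cases h : x ∈ {x | |φ x| ≤ k}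
  · rw [Set.indicator_of_mem h]
    exact h
  · simp [Set.indicator_of_notMem h]

/-- Every vector is approximated by conditionally bounded ones, obtained by restricting it to sets
of `n`. -/
lemma exists_isCondBounded_norm_sub_lt (hn : n ≤ mX) (f : Lp ℝ 2 μ) {ε : ℝ} (hε : 0 < ε) :
    ∃ (s : Set X) (h : Lp ℝ 2 μ) (C : ℝ), MeasurableSet[n] s ∧
      (h =ᵐ[μ] fun x => s.indicator 1 x * f x) ∧ 0 ≤ C ∧ IsCondBounded n C h ∧ ‖f - h‖ < ε := by
  have hs : ∀ k : ℕ, MeasurableSet[n] {x | |condInner n f f x| ≤ k} := fun k =>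
    measurableSet_abs_le (stronglyMeasurable_condInner f f) k
  choose t ht using fun k : ℕ => exists_mul_of_bounded hn (stronglyMeasurable_indicator_one (hs k))
    (abs_indicator_one_le _) f
  have hlim := tendsto_truncation (a := condInner n f f) f t fun k => by
    filter_upwards [ht k] with x hx
    rw [hx]
    by_cases h : x ∈ {x | |condInner n f f x| ≤ k}
    · rw [Set.indicator_of_mem h, Set.indicator_of_mem h, Pi.one_apply, one_mul]
    · rw [Set.indicator_of_notMem h, Set.indicator_of_notMem h, zero_mul]
  obtain ⟨k, hk⟩ := ((Metric.tendsto_nhds.1 hlim) ε hε).exists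
  refine ⟨_, t k, k + 1, hs k, ht k, by positivity, ?_, by rwa [dist_comm, dist_eq_norm] at hk⟩
  filter_upwards [condInner_mul_mul (stronglyMeasurable_indicator_one (hs k)) (ht k)] with x hx
  have hk0 : (0 : ℝ) ≤ k := Nat.cast_nonneg k
  rw [hx]
  by_cases h : x ∈ {x | |condInner n f f x| ≤ k}
  · have h1 : |condInner n f f x| ≤ k := h
    rw [Set.indicator_of_mem h, Pi.one_apply, one_pow, one_mul]
    nlinarith [le_abs_self (condInner n f f x)]
  · rw [Set.indicator_of_notMem h]
    nlinarith

end Approximation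

/-! ### Continuity of the averaged correlations -/

section Correlations

variable {G : Type*} [Group G] [MeasurableSpace G] {X : Type*} {n : MeasurableSpace X}
  [mX : MeasurableSpace X] [MulAction G X] [MeasurableSMul₂ G X] {μ : Measure X}
  [SMulInvariantMeasure G X μ] [IsProbabilityMeasure μ]

lemma norm_add_sq_le {E : Type*} [SeminormedAddCommGroup E] (x y : E) :
    ‖x + y‖ ^ 2 ≤ 2 * ‖x‖ ^ 2 + 2 * ‖y‖ ^ 2 := by
  nlinarith [norm_add_le x y, norm_nonneg (x + y), sq_nonneg (‖x‖ - ‖y‖), norm_nonneg x,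
    norm_nonneg y]

lemma norm_sq_le_of_norm_sub {C : ℝ} {D : Lp ℝ 2 μ →L[ℝ] Lp ℝ 2 μ} (hDC : ∀ φ, ‖D φ‖ ≤ C * ‖φ‖)
    (f f' : Lp ℝ 2 μ) : ‖D f‖ ^ 2 ≤ 2 * ‖D f'‖ ^ 2 + 2 * C ^ 2 * ‖f - f'‖ ^ 2 := by
  have h1 := norm_add_sq_le (D f') (D (f - f'))
  rw [← map_add, add_sub_cancel] at h1
  have h2 : ‖D (f - f')‖ ^ 2 ≤ (C * ‖f - f'‖) ^ 2 :=
    pow_le_pow_left₀ (norm_nonneg _) (hDC _) 2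
  nlinarith

lemma corr_le_of_left (hn : n ≤ mX) {C : ℝ} (hC : 0 ≤ C) {φ : Lp ℝ 2 μ} (hφ : IsCondBounded n C φ)
    (f f' : Lp ℝ 2 μ) (g : G) :
    corr n φ f g ≤ 2 * corr n φ f' g + 2 * C ^ 2 * ‖f - f'‖ ^ 2 := by
  obtain ⟨D, hD, hDC⟩ := exists_condInnerL hn hC hφ
  rw [corr_eq_norm_sq hD, corr_eq_norm_sq hD, ← norm_koopman g (f - f')]
  have h := norm_sq_le_of_norm_sub hDC (koopman μ g f) (koopman μ g f')
  rwa [← koopmanLI_apply g (f - f'), map_sub]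

lemma corr_le_of_right (hn : n ≤ mX) (hinv : ∀ g : G, @Measurable X X n n fun x => g • x) {C : ℝ}
    (hC : 0 ≤ C) {f : Lp ℝ 2 μ} (hf : IsCondBounded n C f) (φ φ' : Lp ℝ 2 μ) (g : G) :
    corr n φ f g ≤ 2 * corr n φ' f g + 2 * C ^ 2 * ‖φ - φ'‖ ^ 2 := by
  obtain ⟨D, hD, hDC⟩ := exists_condInnerL hn hC (hf.koopman hn hinv g)
  have h1 : ∀ ψ, corr n ψ f g = ‖D ψ‖ ^ 2 := by
    intro ψ
    rw [norm_sq_eq_integral]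
    refine integral_congr_ae ?_
    filter_upwards [hD ψ] with x hx
    rw [hx, condInner_comm ψ]
  rw [h1, h1]
  exact norm_sq_le_of_norm_sub hDC φ φ'

lemma exists_pos_forall_sq_le (C : ℝ) {ε : ℝ} (hε : 0 < ε) :
    ∃ δ > 0, ∀ t : ℝ, 0 ≤ t → t < δ → 2 * C ^ 2 * t ^ 2 ≤ ε := by
  have hK : 0 < 2 * C ^ 2 + 1 := by positivity
  refine ⟨Real.sqrt (ε / (2 * C ^ 2 + 1)), Real.sqrt_pos.2 (div_pos hε hK), fun t ht htδ => ?_⟩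
  have h1 : t ^ 2 ≤ ε / (2 * C ^ 2 + 1) := by
    rw [← Real.sq_sqrt (div_pos hε hK).le]
    exact pow_le_pow_left₀ ht htδ.le 2
  rw [le_div_iff₀ hK] at h1
  nlinarith [sq_nonneg t]

variable [SecondCountableTopology (Lp ℝ 2 μ)] {m : Measure G} {Φ : ℕ → Set G}

lemma tendsto_average_two_mul {q : G → ℝ}
    (h : Tendsto (fun N => ⨍ g in Φ N, q g ∂m) atTop (𝓝 0)) :
    Tendsto (fun N => ⨍ g in Φ N, 2 * q g ∂m) atTop (𝓝 0) := by
  simpa only [setAverage_const_mul, mul_zero] using h.const_mul 2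

lemma tendsto_average_corr_of_approx_left (h0 : ∀ N, m (Φ N) ≠ 0) (htop : ∀ N, m (Φ N) ≠ ∞)
    (hn : n ≤ mX) {C : ℝ} (hC : 0 ≤ C) {φ : Lp ℝ 2 μ} (hφ : IsCondBounded n C φ) (f : Lp ℝ 2 μ)
    (h : ∀ ε > 0, ∃ f' : Lp ℝ 2 μ, ‖f - f'‖ < ε ∧
      Tendsto (fun N => ⨍ g in Φ N, corr n φ f' g ∂m) atTop (𝓝 0)) :
    Tendsto (fun N => ⨍ g in Φ N, corr n φ f g ∂m) atTop (𝓝 0) := by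
  refine tendsto_setAverage_of_le_add h0 htop (corr_nonneg φ f) fun ε hε => ?_
  obtain ⟨δ, hδ, hδε⟩ := exists_pos_forall_sq_le C hε
  obtain ⟨f', hf', hlim⟩ := h δ hδ
  exact ⟨fun g => 2 * corr n φ f' g,
    fun N => (integrableOn_corr hn hC hφ f' (htop N)).const_mul 2, tendsto_average_two_mul hlim,
    fun g => (corr_le_of_left hn hC hφ f f' g).trans
      (by gcongr; exact hδε _ (norm_nonneg _) hf')⟩

lemma tendsto_average_corr_of_approx_right (h0 : ∀ N, m (Φ N) ≠ 0) (htop : ∀ N, m (Φ N) ≠ ∞)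
    (hn : n ≤ mX) (hinv : ∀ g : G, @Measurable X X n n fun x => g • x) {C : ℝ} (hC : 0 ≤ C)
    {f : Lp ℝ 2 μ} (hf : IsCondBounded n C f) (φ : Lp ℝ 2 μ)
    (h : ∀ ε > 0, ∃ (φ' : Lp ℝ 2 μ) (K : ℝ), ‖φ - φ'‖ < ε ∧ 0 ≤ K ∧ IsCondBounded n K φ' ∧
      Tendsto (fun N => ⨍ g in Φ N, corr n φ' f g ∂m) atTop (𝓝 0)) :
    Tendsto (fun N => ⨍ g in Φ N, corr n φ f g ∂m) atTop (𝓝 0) := by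
  refine tendsto_setAverage_of_le_add h0 htop (corr_nonneg φ f) fun ε hε => ?_
  obtain ⟨δ, hδ, hδε⟩ := exists_pos_forall_sq_le C hε
  obtain ⟨φ', K, hφ', hK, hφK, hlim⟩ := h δ hδ
  exact ⟨fun g => 2 * corr n φ' f g,
    fun N => (integrableOn_corr hn hK hφK f (htop N)).const_mul 2, tendsto_average_two_mul hlim,
    fun g => (corr_le_of_right hn hinv hC hf φ φ' g).trans
      (by gcongr; exact hδε _ (norm_nonneg _) hφ')⟩

end Correlations

/-! ### Weakly mixing functions -/

section WeaklyMixing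

variable {G : Type*} [Group G] [MeasurableSpace G]
  {X : Type*} [mX : MeasurableSpace X] [MulAction G X] [MeasurableSMul₂ G X]
  {Y : Type*} [mY : MeasurableSpace Y] [MulAction G Y] [MeasurableSMul₂ G Y]
  {μ : Measure X} [SMulInvariantMeasure G X μ] {ν : Measure Y} [SMulInvariantMeasure G Y ν]
  {π : X → Y} [IsProbabilityMeasure μ] [IsProbabilityMeasure ν] {m : Measure G} {Φ : ℕ → Set G}

lemma mem_weaklyMixing_iff (f : Lp ℝ 2 μ) :
    f ∈ weaklyMixing m Φ μ π ↔ ∀ (φ : Lp ℝ 2 μ) (C : ℝ), (∀ᵐ x ∂μ, |φ x| ≤ C) →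
      Tendsto (fun N => ⨍ g in Φ N, corr (mY.comap π) φ f g ∂m) atTop (𝓝 0) := by
  have key : ∀ (ψ : Lp ℝ ∞ μ) (φ : Lp ℝ 2 μ), ψ =ᵐ[μ] φ → ∀ g : G,
      ∫ x, |(μ[((ψ • koopman μ g f : Lp ℝ 2 μ) : X → ℝ) | mY.comap π]) x| ^ 2 ∂μ =
        corr (mY.comap π) φ f g := by
    intro ψ φ h g
    refine integral_congr_ae ?_
    have h1 : ((ψ • koopman μ g f : Lp ℝ 2 μ) : X → ℝ) =ᵐ[μ] fun x => φ x * koopman μ g f x := by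
      filter_upwards [Lp.coeFn_lpSMul (r := 2) ψ (koopman μ g f), h] with x h1 h2
      rw [h1, Pi.smul_apply', h2, smul_eq_mul]
    filter_upwards [condExp_congr_ae (m := mY.comap π) h1] with x hx
    rw [sq_abs, hx]
    rfl
  constructor
  · intro hf φ C hφ
    have hm : MemLp φ ∞ μ := memLp_top_of_bound (Lp.aestronglyMeasurable φ) C hφ
    simpa only [key hm.toLp φ hm.coeFn_toLp] using hf hm.toLp
  · intro hf ψ
    have hm : MemLp ψ 2 μ := (Lp.memLp ψ).mono_exponent le_top
    have hb : ∀ᵐ x ∂μ, |hm.toLp ψ x| ≤ ‖ψ‖ := by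
      filter_upwards [hm.coeFn_toLp, ae_le_eLpNormEssSup (f := ψ) (μ := μ)] with x h1 h2
      rw [h1, Lp.norm_def, ← Real.norm_eq_abs, ← toReal_enorm, eLpNorm_exponent_top]
      exact ENNReal.toReal_mono (by simpa using Lp.eLpNorm_ne_top ψ) h2
    simpa only [key ψ hm.toLp hm.coeFn_toLp.symm] using hf hm.toLp _ hb

variable [SecondCountableTopology (Lp ℝ 2 μ)]

/-- The weakly mixing functions as a subspace of `L²`. -/
def weaklyMixingSubmodule (hπ : IsFactorMap G μ ν π) (h0 : ∀ N, m (Φ N) ≠ 0)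
    (htop : ∀ N, m (Φ N) ≠ ∞) : Submodule ℝ (Lp ℝ 2 μ) where
  carrier := weaklyMixing m Φ μ π
  zero_mem' := by
    rw [mem_weaklyMixing_iff]
    intro φ C hφ
    obtain ⟨K, hK, hφK⟩ := exists_isCondBounded_of_bounded hπ.comap_le hφ
    obtain ⟨D, hD, -⟩ := exists_condInnerL hπ.comap_le hK hφK
    simp [corr_eq_norm_sq hD, ← koopmanLI_apply]
  add_mem' {f f'} hf hf' := by
    rw [mem_weaklyMixing_iff] at *
    intro φ C hφ
    obtain ⟨K, hK, hφK⟩ := exists_isCondBounded_of_bounded hπ.comap_le hφ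
    obtain ⟨D, hD, -⟩ := exists_condInnerL hπ.comap_le hK hφK
    have hi : ∀ (f : Lp ℝ 2 μ) (N : ℕ),
        IntegrableOn (fun g : G => 2 * corr (mY.comap π) φ f g) (Φ N) m := fun f N =>
      (integrableOn_corr hπ.comap_le hK hφK f (htop N)).const_mul 2
    refine tendsto_setAverage_of_le_add h0 htop (corr_nonneg φ _) fun ε hε =>
      ⟨fun g => 2 * corr (mY.comap π) φ f g + 2 * corr (mY.comap π) φ f' g,
        fun N => (hi f N).add (hi f' N), ?_, fun g => ?_⟩
    · have h1 := (tendsto_average_two_mul (hf φ C hφ)).add (tendsto_average_two_mul (hf' φ C hφ))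
      rw [add_zero] at h1
      exact h1.congr fun N => (setAverage_add (hi f N) (hi f' N)).symm
    · simp only [corr_eq_norm_sq hD]
      rw [← koopmanLI_apply, map_add, map_add]
      exact (norm_add_sq_le _ _).trans (le_add_of_nonneg_right hε.le)
  smul_mem' c f hf := by
    rw [mem_weaklyMixing_iff] at *
    intro φ C hφ
    obtain ⟨K, hK, hφK⟩ := exists_isCondBounded_of_bounded hπ.comap_le hφ
    obtain ⟨D, hD, -⟩ := exists_condInnerL hπ.comap_le hK hφK
    have h1 : ∀ g : G, corr (mY.comap π) φ (c • f) g = c ^ 2 * corr (mY.comap π) φ f g := by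
      intro g
      rw [corr_eq_norm_sq hD, corr_eq_norm_sq hD, ← koopmanLI_apply, map_smul, map_smul, norm_smul,
        mul_pow, Real.norm_eq_abs, sq_abs]
      rfl
    simp only [h1, setAverage_const_mul]
    simpa using (hf φ C hφ).const_mul (c ^ 2)

lemma isClosed_weaklyMixingSubmodule (hπ : IsFactorMap G μ ν π) (h0 : ∀ N, m (Φ N) ≠ 0)
    (htop : ∀ N, m (Φ N) ≠ ∞) :
    IsClosed (weaklyMixingSubmodule hπ h0 htop : Set (Lp ℝ 2 μ)) := by
  refine isClosed_of_closure_subset fun f hf => (mem_weaklyMixing_iff f).2 fun φ C hφ => ?_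
  obtain ⟨K, hK, hφK⟩ := exists_isCondBounded_of_bounded hπ.comap_le hφ
  refine tendsto_average_corr_of_approx_left h0 htop hπ.comap_le hK hφK f fun ε hε => ?_
  obtain ⟨f', hf', hd⟩ := Metric.mem_closure_iff.1 hf ε hε
  rw [dist_eq_norm] at hd
  exact ⟨f', hd, (mem_weaklyMixing_iff f').1 hf' φ C hφ⟩

/-- Restricting a weakly mixing function to a set of the factor keeps it weakly mixing. -/
lemma indicator_mul_mem_weaklyMixing (hπ : IsFactorMap G μ ν π) (htop : ∀ N, m (Φ N) ≠ ∞)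
    {f f' : Lp ℝ 2 μ} (hf : f ∈ weaklyMixing m Φ μ π) {s : Set X}
    (hs : MeasurableSet[mY.comap π] s) (hf' : f' =ᵐ[μ] fun x => s.indicator 1 x * f x) :
    f' ∈ weaklyMixing m Φ μ π := by
  rw [mem_weaklyMixing_iff] at *
  intro φ C hφ
  obtain ⟨K, hK, hφK⟩ := exists_isCondBounded_of_bounded hπ.comap_le hφ
  obtain ⟨D, hD, -⟩ := exists_condInnerL hπ.comap_le hK hφK
  have hle : ∀ g : G, corr (mY.comap π) φ f' g ≤ corr (mY.comap π) φ f g := by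
    intro g
    rw [corr_eq_norm_sq hD f g, norm_sq_eq_integral]
    refine integral_mono_of_nonneg (Eventually.of_forall fun x => sq_nonneg _)
      (Lp.memLp _).integrable_sq ?_
    have h1 : koopman μ g f' =ᵐ[μ] fun x => s.indicator 1 (g • x) * koopman μ g f x := by
      filter_upwards [koopman_ae g f', koopman_ae g f, ae_smul hf' g] with x e1 e2 e3
      rw [e1, e2, e3]
    filter_upwards [condInner_mul_right ((stronglyMeasurable_indicator_one hs).comp_measurable
      (hπ.measurable_smul_comap g)) h1 φ, hD (koopman μ g f)] with x e1 e2
    have h2 := abs_indicator_one_le s (g • x)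
    rw [e1, e2, mul_pow, Function.comp_apply, ← sq_abs (s.indicator 1 (g • x))]
    exact mul_le_of_le_one_left (sq_nonneg _) (pow_le_one₀ (abs_nonneg _) h2)
  refine squeeze_zero (fun N => setAverage_nonneg (corr_nonneg φ f')) (fun N => ?_) (hf φ C hφ)
  exact setAverage_mono_of_nonneg (corr_nonneg φ f') hle
    (integrableOn_corr hπ.comap_le hK hφK f (htop N))

/-- Eigenfunctions are orthogonal to conditionally bounded weakly mixing functions `f`: expanding
`T^g e` in a finite frame `u` bounds `⟨e, f⟩² = ⟨T^g e, T^g f⟩²` by the conditional correlations of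
the `uᵢ` with `T^g f`, whose averages over `g` vanish. -/
lemma inner_eq_zero_of_isCondBounded (hπ : IsFactorMap G μ ν π) (h0 : ∀ N, m (Φ N) ≠ 0)
    (htop : ∀ N, m (Φ N) ≠ ∞) {e f : Lp ℝ 2 μ} (he : IsEigenfunction hπ e)
    (hf : f ∈ weaklyMixing m Φ μ π) {C : ℝ} (hC : 0 ≤ C)
    (hfC : IsCondBounded (mY.comap π) C f) : inner ℝ e f = 0 := by
  have hn := hπ.comap_le
  obtain ⟨d, M, hM, hMinv, hd, heM⟩ := (isEigenfunction_iff hπ e).1 he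
  obtain ⟨φ, -, hgen⟩ := hM.exists_generators hn hd
  obtain ⟨u, B, hu, hugen⟩ := exists_frame_of_generators hn d φ
  have hMu : GeneratedBy (mY.comap π) u M := fun N hN hN' => hgen N hN (hugen N hN hN')
  choose D hD hDC using fun i => exists_condInnerL hn zero_le_one (hu.isCondBounded i)
  have hlim : ∀ i, Tendsto (fun N => ⨍ g in Φ N, corr (mY.comap π) (u i) f g ∂m) atTop (𝓝 0) := by
    intro i
    refine tendsto_average_corr_of_approx_right h0 htop hn hπ.measurable_smul_comap hC hfC (u i)
      fun ε hε => ?_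
    obtain ⟨ψ, K, hψ, hψε⟩ := exists_bounded_norm_sub_lt (u i) hε
    obtain ⟨K', hK', hψK'⟩ := exists_isCondBounded_of_bounded hn hψ
    exact ⟨ψ, K', hψε, hK', hψK', (mem_weaklyMixing_iff f).1 hf ψ K hψ⟩
  have hbound : ∀ g : G, |inner ℝ e f| ≤ ∑ i, ‖e‖ * ‖D i (koopman μ g f)‖ := by
    intro g
    have h1 : inner ℝ e f = ∑ i, inner ℝ (D i (koopman μ g e)) (D i (koopman μ g f)) := by
      rw [← inner_koopman g e f, ← integral_condInner hn]
      simp only [inner_eq_integral_mul]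
      rw [← integral_finsetSum _ fun i _ => integrable_mul_Lp _ _]
      obtain ⟨p, hp, -⟩ := hu.exists_projection hn (koopman μ g e)
      have h2 : koopman μ g e = ∑ i, p i := by
        refine Lp.ext ?_
        filter_upwards [(hu.eq_sum_of_generatedBy hn hMu (hMinv g e heM)).1, ae_all_iff.2 hp,
          Lp.coeFn_fun_finsetSum Finset.univ p] with x e1 e2 e3
        rw [e1, e3]
        exact Finset.sum_congr rfl fun i _ => (e2 i).symm
      refine integral_congr_ae ?_
      have h3 := condInner_sum_right (n := mY.comap π) Finset.univ (koopman μ g f) p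
      rw [← h2, condInner_comm] at h3
      filter_upwards [h3, ae_all_iff.2 fun i => condInner_mul_right
        (stronglyMeasurable_condInner (u i) (koopman μ g e)) (hp i) (koopman μ g f),
        ae_all_iff.2 fun i => hD i (koopman μ g e), ae_all_iff.2 fun i => hD i (koopman μ g f)]
        with x e1 e2 e3 e4
      rw [e1]
      refine Finset.sum_congr rfl fun i _ => ?_
      rw [e2 i, e3 i, e4 i, condInner_comm (koopman μ g f)]
    rw [h1]
    refine (Finset.abs_sum_le_sum_abs _ _).trans (Finset.sum_le_sum fun i _ => ?_)
    refine (abs_real_inner_le_norm _ _).trans ?_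
    have h2 := hDC i (koopman μ g e)
    rw [one_mul, norm_koopman] at h2
    exact mul_le_mul_of_nonneg_right h2 (norm_nonneg _)
  have hsq : ∀ g : G, (inner ℝ e f) ^ 2 ≤
      ∑ i, (d * ‖e‖ ^ 2) * corr (mY.comap π) (u i) f g := by
    intro g
    rw [← sq_abs]
    refine (pow_le_pow_left₀ (abs_nonneg _) (hbound g) 2).trans ?_
    refine sq_sum_le_card_mul_sum_sq.trans (le_of_eq ?_)
    rw [Finset.card_univ, Fintype.card_fin, Finset.mul_sum]
    refine Finset.sum_congr rfl fun i _ => ?_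
    rw [corr_eq_norm_sq (hD i)]
    ring
  have hint : ∀ i N, IntegrableOn (fun g : G => (d * ‖e‖ ^ 2) * corr (mY.comap π) (u i) f g)
      (Φ N) m := fun i N =>
    (integrableOn_corr hn zero_le_one (hu.isCondBounded i) f (htop N)).const_mul _
  have hzero := tendsto_setAverage_of_le_add (m := m) (Φ := Φ) (q := fun _ => (inner ℝ e f) ^ 2)
    h0 htop (fun _ => sq_nonneg _) fun ε hε =>
      ⟨fun g => ∑ i, (d * ‖e‖ ^ 2) * corr (mY.comap π) (u i) f g,
        fun N => integrable_finsetSum _ fun i _ => hint i N, ?_,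
        fun g => (hsq g).trans (le_add_of_nonneg_right hε.le)⟩
  · have h1 : ∀ N, ⨍ _g in Φ N, (inner ℝ e f) ^ 2 ∂m = (inner ℝ e f) ^ 2 := fun N =>
      setAverage_const (h0 N) (htop N) _
    simp only [h1] at hzero
    exact pow_eq_zero_iff two_ne_zero |>.1 (tendsto_nhds_unique tendsto_const_nhds hzero)
  · have h1 := tendsto_finsetSum (Finset.univ : Finset (Fin d)) fun i _ =>
      (hlim i).const_mul ((d : ℝ) * ‖e‖ ^ 2)
    simp only [mul_zero, Finset.sum_const_zero] at h1
    refine h1.congr fun N => ?_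
    rw [setAverage_eq, integral_finsetSum _ fun i _ => hint i N, Finset.smul_sum]
    refine Finset.sum_congr rfl fun i _ => ?_
    rw [← setAverage_const_mul, setAverage_eq]

lemma eig_isOrtho_weaklyMixing (hπ : IsFactorMap G μ ν π) (h0 : ∀ N, m (Φ N) ≠ 0)
    (htop : ∀ N, m (Φ N) ≠ ∞) : eig hπ ⟂ weaklyMixingSubmodule hπ h0 htop := by
  refine Submodule.topologicalClosure_minimal _ (Submodule.span_le.2 fun e he => ?_)
    (Submodule.isClosed_orthogonal _)
  rw [SetLike.mem_coe, Submodule.mem_orthogonal']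
  intro f hf
  have hcl : IsClosed {f : Lp ℝ 2 μ | inner ℝ e f = 0} :=
    isClosed_eq (continuous_const.inner continuous_id) continuous_const
  refine hcl.closure_subset (Metric.mem_closure_iff.2 fun ε hε => ?_)
  obtain ⟨s, f', C, hs, hf', hC, hfC, hε'⟩ := exists_isCondBounded_norm_sub_lt hπ.comap_le f hε
  exact ⟨f', inner_eq_zero_of_isCondBounded hπ h0 htop he
    (indicator_mul_mem_weaklyMixing hπ htop hf hs hf') hC hfC, by rwa [dist_eq_norm]⟩

/-- Functions orthogonal to the eigenfunctions are weakly mixing. In `𝔼(φ · T^g f | Y)` the test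
function `φ` may be replaced by its projection to the complement of the eigenfunctions, and then the
decay of correlations applies with `φ` as the fixed vector and `f` as the moving one. -/
lemma orthogonal_eig_le_weaklyMixing [MeasurableMul G] [m.IsMulLeftInvariant]
    (hπ : IsFactorMap G μ ν π) (hΦ : IsFoelner G m atTop Φ) (hmeas : ∀ N, MeasurableSet (Φ N))
    (h0 : ∀ N, m (Φ N) ≠ 0) (htop : ∀ N, m (Φ N) ≠ ∞) :
    (eig hπ)ᗮ ≤ weaklyMixingSubmodule hπ h0 htop := by
  have hn := hπ.comap_le
  have hinv := hπ.measurable_smul_comap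
  have hE := isClosedModule_eig hπ
  have hE' := hE.orthogonal hn
  have hcomplete : CompleteSpace (eig hπ) := hE.isClosed.completeSpace_coe
  intro f hf
  refine (mem_weaklyMixing_iff f).2 fun φ K hφ => ?_
  obtain ⟨K', hK', hφK'⟩ := exists_isCondBounded_of_bounded hn hφ
  refine tendsto_average_corr_of_approx_left h0 htop hn hK' hφK' f fun ε hε => ?_
  obtain ⟨s, f', C, hs, hf's, hC, hfC, hfε⟩ := exists_isCondBounded_norm_sub_lt hn f hε
  have hf' : f' ∈ (eig hπ)ᗮ := hE'.mul_mem hn (stronglyMeasurable_indicator_one hs) hf hf's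
  refine ⟨f', hfε, ?_⟩
  obtain ⟨e, he, v, hv, rfl⟩ := (eig hπ).exists_add_mem_mem_orthogonal φ
  have hcorr : ∀ g : G, corr (mY.comap π) (e + v) f' g = corr (mY.comap π) v f' g := by
    intro g
    refine integral_congr_ae ?_
    have hgf : koopman μ g f' ∈ (eig hπ)ᗮ := by
      rw [Submodule.mem_orthogonal]
      intro e' he'
      have h1 := inner_koopman g (koopman μ g⁻¹ e') f'
      rw [koopman_koopman, inv_mul_cancel, koopman_one] at h1
      rw [h1]
      exact Submodule.inner_right_of_mem_orthogonal (koopman_mem_eig hπ g⁻¹ e' he') hf'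
    filter_upwards [condInner_add_right (n := mY.comap π) (koopman μ g f') e v,
      hE.condInner_eq_zero hn hgf he] with x h1 h2
    rw [condInner_comm, h1, h2, condInner_comm v]
    simp
  simp only [hcorr]
  refine tendsto_average_corr_of_approx_right h0 htop hn hinv hC hfC v fun δ hδ => ?_
  obtain ⟨s', v', K₁, hs', hv's, hK₁, hvK₁, hvδ⟩ := exists_isCondBounded_norm_sub_lt hn v hδ
  have hv' : v' ∈ (eig hπ)ᗮ := hE'.mul_mem hn (stronglyMeasurable_indicator_one hs') hv hv's
  exact ⟨v', K₁, hvδ, hK₁, hvK₁, tendsto_average_corr_of_mem_orthogonal hΦ hmeas h0 htop hn hinv hE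
    (koopman_mem_eig hπ) (le_eig hπ) hK₁ hvK₁ hv' f'⟩

end WeaklyMixing

end RelativeMixing

end

theorem mainTheorem8
    {G : Type*} [Group G] [TopologicalSpace G] [IsTopologicalGroup G] [T2Space G]
    [LocallyCompactSpace G] [SecondCountableTopology G] [MeasurableSpace G] [BorelSpace G]
    (m : Measure G) [m.IsHaarMeasure]
    (Φ : ℕ → Set G) (hΦ_compact : ∀ N, IsCompact (Φ N)) (hΦ_pos : ∀ N, 0 < m (Φ N))
    (hΦ : IsFoelner G m atTop Φ)
    {X : Type*} [MeasurableSpace X] [MeasurableSpace.CountablyGenerated X]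
    [MeasurableSpace.SeparatesPoints X] [MulAction G X] [MeasurableSMul₂ G X]
    (μ : Measure X) [IsProbabilityMeasure μ] [SMulInvariantMeasure G X μ]
    {Y : Type*} [MeasurableSpace Y] [MeasurableSpace.CountablyGenerated Y]
    [MeasurableSpace.SeparatesPoints Y] [MulAction G Y] [MeasurableSMul₂ G Y]
    (ν : Measure Y) [IsProbabilityMeasure ν] [SMulInvariantMeasure G Y ν]
    (π : X → Y) (hπ : RelativeMixing.IsFactorMap G μ ν π) :
    ∃ W : Submodule ℝ (Lp ℝ 2 μ),
      (W : Set (Lp ℝ 2 μ)) = RelativeMixing.weaklyMixing m Φ μ π ∧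
      IsClosed (W : Set (Lp ℝ 2 μ)) ∧
      RelativeMixing.eig hπ ⟂ W ∧
      IsCompl (RelativeMixing.eig hπ) W := by
  have h0 : ∀ N, m (Φ N) ≠ 0 := fun N => (hΦ_pos N).ne'
  have htop : ∀ N, m (Φ N) ≠ ∞ := fun N => (hΦ_compact N).measure_lt_top.ne
  have hmeas : ∀ N, MeasurableSet (Φ N) := fun N => (hΦ_compact N).measurableSet
  have : Fact ((2 : ℝ≥0∞) ≠ ∞) := ⟨ENNReal.ofNat_ne_top⟩
  have hort := RelativeMixing.eig_isOrtho_weaklyMixing hπ h0 htop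
  have hcomplete : CompleteSpace (RelativeMixing.eig hπ) :=
    (RelativeMixing.isClosedModule_eig hπ).isClosed.completeSpace_coe
  refine ⟨RelativeMixing.weaklyMixingSubmodule hπ h0 htop, rfl,
    RelativeMixing.isClosed_weaklyMixingSubmodule hπ h0 htop, hort, hort.disjoint, ?_⟩
  exact (RelativeMixing.eig hπ).isCompl_orthogonal.codisjoint.mono_right
    (RelativeMixing.orthogonal_eig_le_weaklyMixing hπ hΦ hmeas h0 htop)
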